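/- **Setting.** A *timed word* over a finite alphabet $\Sigma$ is an infinite sequence $(a_1,t_1)(a_2,t_2)\dots$ with $a_i\in\Sigma$ and $0\le t_1<t_2<\cdots$; it is *non-Zeno* if $(t_i)$ is unbounded. A *one-clock alternating timed automaton* $\mathcal A=\langle Q,\Sigma,q_0,\delta,\Omega\rangle$ consists of a finite set $Q$ of states, a finite alphabet $\Sigma$, a state $q_0\in Q$, a rank function $\Omega:Q\to\mathbb N$, and a finite partial function $\delta$ that maps triples $(q,a,\theta)$ of a state, a letter and a clock constraint (a finite conjunction of comparisons of the clock $x$ with natural numbers) to positive boolean formulas over $\top$, $\bot$ and atoms $(q',f)$ with $q'\in Q$, $f\in\{\mathrm{nop},\mathrm{reset}\}$, such that for all $q$, $a$ and $v\ge 0$ there is at most one $\theta$ satisfied by $v$ with $\delta(q,a,\theta)$ defined. In the *acceptance game* of $\mathcal A$ on $w$, put $t_0=0$. A play starts in $(q_0,0)$; phase $k+1$ starts in a configuration $(q_k,v_k)$, the clock advances to $v'=v_k+t_{k+1}-t_k$, and $b:=\delta(q_k,a_{k+1},\theta)$ is taken for the unique $\theta$ satisfied by $v'$ for which it is defined (if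 there is none, Eve is blocked and loses). If $b$ is a conjunction, Adam chooses a conjunct, if it is a disjunction, Eve chooses a disjunct, and the phase continues with it; at an atom $(q',f)$ the next configuration is $(q',v')$ if $f=\mathrm{nop}$ and $(q',0)$ if $f=\mathrm{reset}$; at $\top$ Eve wins, and at $\bot$ she loses. An infinite play is won by Eve iff the *weak parity condition* holds: the minimum of the ranks of all states that occur in it is even. The automaton *accepts* $w$ if Eve has a winning strategy. It is *universal* if no disjunction occurs in the values of $\delta$, and it has *weak $(1,2)$ conditions* if acceptance is by the weak parity condition and the minimal and maximal values of $\Omega$ on $Q$ are $1$ and $2$. **Theorem 5.2.** It is undecidable whether a given one-clock universal timed automaton with weak $(1,2)$ conditions accepts some non-Zeno timed word, even for automata that use no tests for equality and, moreover, only test whether the clock exceeds $1$ (each constraint in $\delta$ is $x>1$ or $x\le 1$). That is, no algorithm halts with the correct answer on every such automaton. -/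

import Mathlib

namespace OneClock

/-! ### One-clock alternating timed automata, as finite objects -/

/-- The comparison relations that may occur in a clock constraint. -/
inductive Cmp
  | lt | le | eq | ge | gt

/-- `r.holds v c` is the comparison of the clock value `v` with the constant `c`. -/
def Cmp.holds : Cmp → ℝ → ℕ → Prop
  | .lt, v, c => v < c
  | .le, v, c => v ≤ c
  | .eq, v, c => v = c
  | .ge, v, c => (c : ℝ) ≤ v
  | .gt, v, c => (c : ℝ) < v

/-- A clock constraint: a finite conjunction of comparisons of the clock with constants. -/
abbrev Guard := List (Cmp × ℕ)

/-- The clock value `v` satisfies the constraint. -/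
def Guard.Sat (θ : Guard) (v : ℝ) : Prop := ∀ x ∈ θ, x.1.holds v x.2

/-- Positive boolean formulas over `⊤`, `⊥` and the atoms `(q, f)`, where `q` is a state and `f`
is one of the two operations on the clock: `true` for "reset", `false` for "leave unchanged". -/
inductive Formula
  | top
  | bot
  | atom (q : ℕ) (reset : Bool)
  | and (b c : Formula)
  | or (b c : Formula)

/-- The states that occur in a formula. -/
def Formula.states : Formula → Set ℕ
  | .top => ∅
  | .bot => ∅
  | .atom q _ => {q}
  | .and b c => b.states ∪ c.states
  | .or b c => b.states ∪ c.states

/-- The formula contains no disjunction. -/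
def Formula.NoDisj : Formula → Prop
  | .top => True
  | .bot => True
  | .atom _ _ => True
  | .and b c => b.NoDisj ∧ c.NoDisj
  | .or _ _ => False

/-- One entry `δ(state, letter, guard) = target` of the table of a transition function. -/
structure Rule where
  state : ℕ
  letter : ℕ
  guard : Guard
  target : Formula

/-- A one-clock alternating timed automaton. The states are `0, …, ranks.length - 1`, the letters
are `0, …, numLetters - 1`, the rank of the state `q` is the `q`-th entry of `ranks`, and
the finite partial function `δ` is given by its table `rules`. -/
structure Automaton where
  ranks : List ℕ
  numLetters : ℕ
  start : ℕ
  rules : List Rule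

namespace Automaton

/-- The rank `Ω(q)` of a state. -/
def rank (A : Automaton) (q : ℕ) : ℕ := A.ranks.getD q 0

/-- The data describe an automaton: states and letters are in range, the table is the graph of
a partial function, and for all `q`, `a` and `v ≥ 0` at most one constraint `θ` satisfied
by `v` has `δ(q, a, θ)` defined. -/
structure WellFormed (A : Automaton) : Prop where
  start_mem : A.start < A.ranks.length
  state_mem : ∀ r ∈ A.rules, r.state < A.ranks.length
  letter_mem : ∀ r ∈ A.rules, r.letter < A.numLetters
  target_mem : ∀ r ∈ A.rules, ∀ q ∈ r.target.states, q < A.ranks.length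
  functional : ∀ r ∈ A.rules, ∀ s ∈ A.rules,
    r.state = s.state → r.letter = s.letter → r.guard = s.guard → r.target = s.target
  partition : ∀ r ∈ A.rules, ∀ s ∈ A.rules, r.state = s.state → r.letter = s.letter →
    ∀ v : ℝ, 0 ≤ v → r.guard.Sat v → s.guard.Sat v → r.guard = s.guard

/-- Universal automata: no disjunctions in the transition function. -/
def Universal (A : Automaton) : Prop := ∀ r ∈ A.rules, r.target.NoDisj

/-- The Mostowski index is `(i, j)`: the least rank of a state is `i`, the greatest is `j`. -/
def HasIndex (A : Automaton) (i j : ℕ) : Prop :=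
  IsLeast {n | ∃ q < A.ranks.length, A.rank q = n} i ∧
    IsGreatest {n | ∃ q < A.ranks.length, A.rank q = n} j

/-- No tests for equality: no constraint contains a comparison `x = c`, and none is a disguised
one, true for exactly one clock value. -/
def NoEqualityTests (A : Automaton) : Prop :=
  ∀ r ∈ A.rules, (∀ x ∈ r.guard, x.1 ≠ Cmp.eq) ∧ ∀ c : ℝ, {v : ℝ | 0 ≤ v ∧ r.guard.Sat v} ≠ {c}

/-- The only test is whether the clock exceeds `1`: each constraint is `x > 1` or its negation
`x ≤ 1`. -/
def OnlyTestsAboveOne (A : Automaton) : Prop :=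
  ∀ r ∈ A.rules, r.guard = [(Cmp.gt, 1)] ∨ r.guard = [(Cmp.le, 1)]

end Automaton

/-! ### Timed words and the acceptance game -/

/-- An infinite timed word over the alphabet `0, …, m - 1`, with strictly increasing
time stamps. -/
structure TimedWord (m : ℕ) where
  letter : ℕ → ℕ
  letter_lt : ∀ i, letter i < m
  time : ℕ → ℝ
  time_nonneg : ∀ i, 0 ≤ time i
  time_strictMono : StrictMono time

namespace TimedWord

variable {m : ℕ}

/-- The time stamps are unbounded. -/
def NonZeno (w : TimedWord m) : Prop := ∀ M : ℝ, ∃ i, M < w.time i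

/-- The time that passes just before the letter number `k` (letters are counted from `0`);
the first letter is preceded by the whole time since `0`. -/
def delay (w : TimedWord m) : ℕ → ℝ
  | 0 => w.time 0
  | k + 1 => w.time (k + 1) - w.time k

end TimedWord

/-- Positions of the acceptance game: `conf k q v` is the configuration `(q, v)` when `k` phases
are over, and `form k q v b` is a position inside the next phase, where the clock has
been advanced to `v` and `b` is the current formula. -/
inductive Pos
  | conf (k q : ℕ) (v : ℝ)
  | form (k q : ℕ) (v : ℝ) (b : Formula)

/-- The moves of the acceptance game of `A` on `w`. -/
inductive Move (A : Automaton) (w : TimedWord A.numLetters) : Pos → Pos → Prop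
  | read (k q : ℕ) (v : ℝ) (r : Rule) (hr : r ∈ A.rules) (hq : r.state = q)
      (ha : r.letter = w.letter k) (hv : r.guard.Sat (v + w.delay k)) :
      Move A w (.conf k q v) (.form k q (v + w.delay k) r.target)
  | andLeft (k q : ℕ) (v : ℝ) (b c : Formula) : Move A w (.form k q v (.and b c)) (.form k q v b)
  | andRight (k q : ℕ) (v : ℝ) (b c : Formula) : Move A w (.form k q v (.and b c)) (.form k q v c)
  | orLeft (k q : ℕ) (v : ℝ) (b c : Formula) : Move A w (.form k q v (.or b c)) (.form k q v b)
  | orRight (k q : ℕ) (v : ℝ) (b c : Formula) : Move A w (.form k q v (.or b c)) (.form k q v c)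
  | keep (k q : ℕ) (v : ℝ) (p : ℕ) :
      Move A w (.form k q v (.atom p false)) (.conf (k + 1) p v)
  | reset (k q : ℕ) (v : ℝ) (p : ℕ) :
      Move A w (.form k q v (.atom p true)) (.conf (k + 1) p 0)

/-- Eve chooses at disjunctions. (Adam chooses at conjunctions; elsewhere there is at most one
move.) -/
def Pos.IsEve : Pos → Prop
  | .form _ _ _ (.or _ _) => True
  | _ => False

/-- The formula at the position is `⊤`. -/
def Pos.IsTop : Pos → Prop
  | .form _ _ _ .top => True
  | _ => False

/-- A strategy of Eve: a legal next move for each sequence of positions that ends in a position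
of Eve. Sequences are listed from the last position back to the first. -/
structure Strategy (A : Automaton) (w : TimedWord A.numLetters) where
  next : List Pos → Pos
  legal : ∀ p h, p.IsEve → Move A w p (next (p :: h))

/-- The finite partial plays that respect a strategy of Eve, last position first. -/
inductive Respects {A : Automaton} {w : TimedWord A.numLetters} (σ : Strategy A w) :
    List Pos → Prop
  | start : Respects σ [.conf 0 A.start 0]
  | step (p p' : Pos) (h : List Pos) (hp : Respects σ (p :: h)) (hm : Move A w p p')
      (he : p.IsEve → p' = σ.next (p :: h)) : Respects σ (p' :: p :: h)

/-- The first `n + 1` positions of an infinite play, last position first. -/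
def history (π : ℕ → Pos) (n : ℕ) : List Pos := ((List.range (n + 1)).map π).reverse

/-- The weak parity condition: the least rank of all states in the play is even. -/
def WeakParity (A : Automaton) (π : ℕ → Pos) : Prop :=
  Even (sInf {r | ∃ n k q v, π n = .conf k q v ∧ A.rank q = r})

/-- A strategy is winning if each play that respects it either stops in `⊤` or is infinite and
satisfies the weak parity condition. In particular Eve loses if she is blocked. -/
def Strategy.Winning {A : Automaton} {w : TimedWord A.numLetters} (σ : Strategy A w) : Prop :=
  (∀ p h, Respects σ (p :: h) → (∀ p', ¬ Move A w p p') → p.IsTop) ∧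
    ∀ π : ℕ → Pos, (∀ n, Respects σ (history π n)) → WeakParity A π

/-- Acceptance of a timed word under the weak parity condition. -/
def Automaton.Accepts (A : Automaton) (w : TimedWord A.numLetters) : Prop :=
  ∃ σ : Strategy A w, σ.Winning

/-- The automaton accepts some non-Zeno word. -/
def Automaton.AcceptsNonZeno (A : Automaton) : Prop :=
  ∃ w : TimedWord A.numLetters, w.NonZeno ∧ A.Accepts w

/-! ### Automata as inputs of algorithms -/

/-- `Cmp` has five elements. -/
def Cmp.equivFin : Cmp ≃ Fin 5 where
  toFun r := match r with
    | .lt => 0 | .le => 1 | .eq => 2 | .ge => 3 | .gt => 4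
  invFun i := match i with
    | 0 => .lt | 1 => .le | 2 => .eq | 3 => .ge | 4 => .gt
  left_inv r := by cases r <;> rfl
  right_inv i := by fin_cases i <;> rfl

instance : Primcodable Cmp := Primcodable.ofEquiv _ Cmp.equivFin

/-- The Gödel number of a formula. -/
def Formula.toNat : Formula → ℕ
  | .top => 0
  | .bot => 1
  | .atom q false => 4 * q + 2
  | .atom q true => 4 * q + 3
  | .and b c => 4 * Nat.pair b.toNat c.toNat + 4
  | .or b c => 4 * Nat.pair b.toNat c.toNat + 5

/-- The formula with a given Gödel number. -/
def Formula.ofNat : ℕ → Formula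
  | 0 => .top
  | 1 => .bot
  | n + 2 =>
    have h₁ : (Nat.unpair (n / 4)).1 < n + 2 := by
      have := Nat.unpair_left_le (n / 4)
      omega
    have h₂ : (Nat.unpair (n / 4)).2 < n + 2 := by
      have := Nat.unpair_right_le (n / 4)
      omega
    if n % 4 = 0 then .atom (n / 4) false
    else if n % 4 = 1 then .atom (n / 4) true
    else if n % 4 = 2 then
      .and (Formula.ofNat (Nat.unpair (n / 4)).1) (Formula.ofNat (Nat.unpair (n / 4)).2)
    else .or (Formula.ofNat (Nat.unpair (n / 4)).1) (Formula.ofNat (Nat.unpair (n / 4)).2)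
  termination_by n => n

theorem Formula.ofNat_toNat (b : Formula) : Formula.ofNat b.toNat = b := by
  induction b with
  | top => simp [toNat, ofNat]
  | bot => simp [toNat, ofNat]
  | atom q r =>
    cases r
    · rw [toNat, ofNat]
      simp
    · rw [toNat, show 4 * q + 3 = (4 * q + 1) + 2 by ring, ofNat]
      simp [show (4 * q + 1) % 4 = 1 by omega, show (4 * q + 1) / 4 = q by omega]
  | and b c hb hc =>
    rw [toNat, show ∀ x, 4 * x + 4 = (4 * x + 2) + 2 by intro x; ring, ofNat]
    simp [show ∀ x, (4 * x + 2) % 4 = 2 by omega, show ∀ x, (4 * x + 2) / 4 = x by omega, hb, hc]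
  | or b c hb hc =>
    rw [toNat, show ∀ x, 4 * x + 5 = (4 * x + 3) + 2 by intro x; ring, ofNat]
    simp [show ∀ x, (4 * x + 3) % 4 = 3 by omega, show ∀ x, (4 * x + 3) / 4 = x by omega, hb, hc]

theorem Formula.toNat_ofNat (n : ℕ) : (Formula.ofNat n).toNat = n := by
  induction n using Nat.strong_induction_on with
  | _ n ih =>
    match n with
    | 0 => simp [toNat, ofNat]
    | 1 => simp [toNat, ofNat]
    | n + 2 =>
      have h₁ := ih (Nat.unpair (n / 4)).1 (by
        have := Nat.unpair_left_le (n / 4)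
        omega)
      have h₂ := ih (Nat.unpair (n / 4)).2 (by
        have := Nat.unpair_right_le (n / 4)
        omega)
      rw [ofNat]
      split_ifs
      · rw [toNat]; omega
      · rw [toNat]; omega
      · rw [toNat, h₁, h₂, Nat.pair_unpair]; omega
      · rw [toNat, h₁, h₂, Nat.pair_unpair]; omega

/-- The Gödel numbering of formulas is a bijection. -/
def Formula.equivNat : Formula ≃ ℕ :=
  ⟨Formula.toNat, Formula.ofNat, Formula.ofNat_toNat, Formula.toNat_ofNat⟩

instance : Primcodable Formula := Primcodable.ofEquiv _ Formula.equivNat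

/-- A rule is the quadruple of its components. -/
def Rule.equivProd : Rule ≃ ℕ × ℕ × Guard × Formula where
  toFun r := (r.state, r.letter, r.guard, r.target)
  invFun x := ⟨x.1, x.2.1, x.2.2.1, x.2.2.2⟩
  left_inv _ := rfl
  right_inv _ := rfl

instance : Primcodable Rule := Primcodable.ofEquiv _ Rule.equivProd

/-- An automaton is the quadruple of its components. -/
def Automaton.equivProd : Automaton ≃ List ℕ × ℕ × ℕ × List Rule where
  toFun A := (A.ranks, A.numLetters, A.start, A.rules)
  invFun x := ⟨x.1, x.2.1, x.2.2.1, x.2.2.2⟩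
  left_inv _ := rfl
  right_inv _ := rfl

instance : Primcodable Automaton := Primcodable.ofEquiv _ Automaton.equivProd

/-- The property `P` is decidable on the class `C` of inputs: some algorithm halts with the right
answer on each input from `C`. Nothing is required on other inputs. -/
def DecidableOn {α : Type} [Primcodable α] (C P : α → Prop) : Prop :=
  ∃ f : α →. Bool, Partrec f ∧ ∀ a, C a → ∃ b ∈ f a, (b = true ↔ P a)

end OneClock

/-!
The halting problem of a suitable machine `T`, on inputs `m : ℕ`, is undecidable
(`exists_undecidable_machine`). For each `m` an automaton of the class in question is computed
that accepts some non-Zeno word if and only if `T` does *not* halt on `m`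
(`Machine.acceptsNonZeno_iff`).

A universal automaton can start a copy of itself with clock `0` at each letter of the word. The
copy remembers this letter, keeps track of the letter read last, and thus tests, when its clock
exceeds `1` for the first time, how the letter is related to the last letter in the window of
length `1` that follows it. This letter is called the *image* of the first one. So a non-Zeno word
is a sequence of rows, each beginning with a header and mapped into the next one by taking images
(`Machine.exists_rows`). Each cell holds a symbol of the left and of the right half of the tape, at
the same distance from the head, so that a step of `T` is a local relation between consecutive rows.
But the tests do not notice *insertions*: a row may contain letters that are no images.

Insertions are made harmless by a budget. Some of the cells, which form a prefix of the row, are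
active. A round starts with `T` in the initial configuration, where the right half of the tape
is compared with the input `m` directly. Each step ticks the first cell and moves all other ticks
by one cell, and the round ends only when all active cells are ticked. When it ends, one active cell
may become inactive. A phase ends when no cell is active; then all cells become active and
another cell is added. A state of rank `1`, which is left only when a phase ends, ensures that
infinitely many phases end.

If `T` does not halt, rounds of any length are possible, and there are such rows without any
harmful insertion (`Machine.rows_of_not_halts`). Putting the letter number `p` of the row number `k`
at time `k + p / (p + 1)` makes them a timed word (`Machine.Rows.stream`).

Suppose that `T` halts after `n` steps, and that a round starts with `b ≥ n + 2` active cells. If no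
active cell is inserted, then the first `b` cells cannot be moved, and information travels one cell
per step, so that the first cells show the true configuration of `T` for the first `n` steps
(`Machine.Rows.simulates_round`). Then the round cannot end, as `T` stops before the cell number
`b - 1` is ticked. So an active cell is inserted in each round that ends, and this makes up for the
one that is lost: the next round starts with at least `b` active cells again
(`Machine.Rows.finish_of_halts`), and the phase never ends. But the rows grow with each phase, so
this happens eventually (`Machine.Rows.not_halts`).
-/

open Turing

namespace OneClock

/-! ### A machine with an undecidable halting problem -/

/-- A configuration of a one-tape machine: the state, the scanned symbol, and the two halves of
the tape as sequences that lead away from the head. -/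
structure TapeCfg (Q Γ : Type) where
  q : Q
  head : Γ
  left : ℕ → Γ
  right : ℕ → Γ

/-- The sequence `s` with `a` put in front. -/
def push {Γ : Type} (a : Γ) (s : ℕ → Γ) : ℕ → Γ
  | 0 => a
  | p + 1 => s p

/-- The effect of one instruction on a configuration. -/
def TapeCfg.apply {Q Γ : Type} (C : TapeCfg Q Γ) (q' : Q) : TM0.Stmt Γ → TapeCfg Q Γ
  | .move .right => ⟨q', C.right 0, push C.head C.left, fun p => C.right (p + 1)⟩
  | .move .left => ⟨q', C.left 0, fun p => C.left (p + 1), push C.head C.right⟩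
  | .write a => ⟨q', a, C.left, C.right⟩

/-- One step of the machine with transition function `M`. -/
def tapeStep {Q Γ : Type} (M : Q → Γ → Option (Q × TM0.Stmt Γ)) (C : TapeCfg Q Γ) :
    Option (TapeCfg Q Γ) :=
  (M C.q C.head).map fun x => C.apply x.1 x.2

/-- The word `b₁ b₀ ⋯ b₀` with `m` occurrences of `b₀`, followed by blanks. -/
def inputTape {Γ : Type} (blank b₀ b₁ : Γ) (m p : ℕ) : Γ :=
  if p = 0 then b₁ else if p ≤ m then b₀ else blank

theorem getI_cons_replicate {Γ : Type} [Inhabited Γ] (m : ℕ) (b₀ b₁ : Γ) :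
    (b₁ :: List.replicate m b₀).getI = inputTape default b₀ b₁ m := by
  funext p
  cases p with
  | zero => rfl
  | succ p =>
    rw [List.getI_cons_succ, inputTape, if_neg (Nat.succ_ne_zero p)]
    split_ifs with h
    · rw [List.getI_eq_getElem _ (by simpa using h)]
      simp
    · rw [List.getI_eq_default _ (by simp; omega)]

/-- A one-tape machine on finite types of states and symbols, with an encoding of natural
numbers as inputs: initially the head scans `mark` and the word `b₁ b₀ ⋯ b₀` stands to its right. -/
structure Machine where
  Q : Type
  Γ : Type
  [finQ : Fintype Q]
  [finΓ : Fintype Γ]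
  M : Q → Γ → Option (Q × TM0.Stmt Γ)
  start : Q
  blank : Γ
  mark : Γ
  b₀ : Γ
  b₁ : Γ

attribute [instance] Machine.finQ Machine.finΓ

/-- The initial configuration on input `m`. -/
def Machine.init (T : Machine) (m : ℕ) : TapeCfg T.Q T.Γ :=
  ⟨T.start, T.mark, fun _ => T.blank, inputTape T.blank T.b₀ T.b₁ m⟩

/-- The machine halts on input `m`. -/
def Machine.Halts (T : Machine) (m : ℕ) : Prop :=
  (StateTransition.eval (tapeStep T.M) (T.init m)).Dom

theorem trNat_two_pow (m : ℕ) : PartrecToTM2.trNat (2 ^ m) =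
    List.replicate m PartrecToTM2.Γ'.bit0 ++ [PartrecToTM2.Γ'.bit1] := by
  have key : ∀ m : ℕ, ∃ n : PosNum, ((2 ^ m : ℕ) : Num) = Num.pos n ∧
      PartrecToTM2.trPosNum n =
        List.replicate m PartrecToTM2.Γ'.bit0 ++ [PartrecToTM2.Γ'.bit1] := by
    intro m
    induction m with
    | zero => exact ⟨PosNum.one, by simp; rfl, rfl⟩
    | succ m ih =>
      obtain ⟨n, h₁, h₂⟩ := ih
      refine ⟨n.bit0, ?_, ?_⟩
      · rw [pow_succ, mul_two, Nat.cast_add, h₁, Num.bit0_of_bit0]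
        rfl
      · rw [PartrecToTM2.trPosNum, h₂, List.replicate_succ]
        rfl
  obtain ⟨n, h₁, h₂⟩ := key m
  rw [PartrecToTM2.trNat, h₁, PartrecToTM2.trNum, h₂]

/-- There is a program whose domain, restricted to powers of two, is undecidable. Powers of two are
used because of their simple binary notation, see `trNat_two_pow`. -/
theorem exists_code_undecidable :
    ∃ c : ToPartrec.Code, ¬ ComputablePred fun m : ℕ => (c.eval [2 ^ m]).Dom := by
  let f : ℕ →. ℕ := fun n =>
    (Nat.rfind fun m => (Part.some (decide (2 ^ m = n)) : Part Bool)).bind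
      fun m => (Denumerable.ofNat Nat.Partrec.Code m).eval 0
  have hf : Partrec f := by
    refine Partrec.bind (Partrec.rfind ?_) ?_
    · have hpow : Primrec₂ ((· ^ ·) : ℕ → ℕ → ℕ) := Primrec₂.unpaired'.1 Nat.Primrec.pow
      have : PrimrecPred fun x : ℕ × ℕ => 2 ^ x.2 = x.1 :=
        Primrec.eq.comp (hpow.comp (Primrec.const 2) Primrec.snd) Primrec.fst
      exact this.decide.to_comp.partrec
    · exact Nat.Partrec.Code.eval_part.comp
        ((Computable.ofNat Nat.Partrec.Code).comp Computable.snd) (Computable.const 0)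
  obtain ⟨c, hc⟩ := ToPartrec.Code.exists_code (Nat.Partrec'.part_iff₁.2 hf)
  refine ⟨c, fun h => ?_⟩
  refine ComputablePred.halting_problem 0 ?_
  have key : ∀ m : ℕ, (c.eval [2 ^ m]).Dom ↔
      ((Denumerable.ofNat Nat.Partrec.Code m).eval 0).Dom := by
    intro m
    have h₁ := hc ⟨[2 ^ m], rfl⟩
    have h₂ : f (2 ^ m) = (Denumerable.ofNat Nat.Partrec.Code m).eval 0 := by
      have : (Nat.rfind fun k => (Part.some (decide (2 ^ k = 2 ^ m)) : Part Bool)) =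
          Part.some m := by
        refine Part.eq_some_iff.2 (Nat.mem_rfind.2 ?_)
        refine ⟨by simp, fun {k} hk => ?_⟩
        have : (2 : ℕ) ^ k ≠ 2 ^ m := (Nat.pow_lt_pow_right (by norm_num) hk).ne
        simp [this]
      simp only [f, this, Part.bind_some]
    rw [← h₂]
    have h₃ : c.eval [2 ^ m] = pure <$> f (2 ^ m) := h₁
    rw [h₃]
    rfl
  obtain ⟨g, hg, hg'⟩ := ComputablePred.computable_iff.1 h
  refine ComputablePred.computable_iff.2
    ⟨fun c => g (Encodable.encode c), hg.comp Computable.encode, ?_⟩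
  funext a
  have := key (Encodable.encode a)
  rw [Denumerable.ofNat_encode] at this
  rw [← this, ← congrFun hg' (Encodable.encode a)]

/-- The configuration of `TapeCfg` that stands for a configuration of a `TM0` machine, when all
states of the latter are in the set `S`. -/
def TracksCfg {Γ Λ : Type} [Inhabited Γ] (S : Finset Λ) (c : TM0.Cfg Γ Λ)
    (C : TapeCfg S Γ) : Prop :=
  c.q = C.q ∧ c.Tape.head = C.head ∧ c.Tape.left.nth = C.left ∧ c.Tape.right.nth = C.right

open scoped Classical in
/-- The restriction of the transition function of a `TM0` machine to a set of states. -/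
noncomputable def restrictMachine {Γ Λ : Type} [Inhabited Λ] (M : TM0.Machine Γ Λ) (S : Finset Λ)
    (q : S) (a : Γ) : Option (S × TM0.Stmt Γ) :=
  (M q a).bind fun x => if h : x.1 ∈ S then some (⟨x.1, h⟩, x.2) else none

theorem nth_cons_eq_push {Γ : Type} [Inhabited Γ] (a : Γ) (l : ListBlank Γ) :
    (l.cons a).nth = push a l.nth := by
  funext p
  cases p with
  | zero => simp [push]
  | succ p => simp [push, ListBlank.nth_succ]

theorem respects_restrictMachine {Γ Λ : Type} [Inhabited Γ] [Inhabited Λ] (M : TM0.Machine Γ Λ)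
    (S : Finset Λ) (hS : TM0.Supports M (S : Set Λ)) :
    StateTransition.Respects (TM0.step M) (tapeStep (restrictMachine M S)) (TracksCfg S) := by
  classical
  rintro ⟨q, T⟩ ⟨⟨q', hq'⟩, g, l, r⟩ ⟨h₁, h₂, h₃, h₄⟩
  simp only at h₁ h₂ h₃ h₄
  subst h₁ h₂ h₃ h₄
  have hM : restrictMachine M S ⟨q, hq'⟩ T.head = match M q T.head with
      | none => none
      | some x => if h : x.1 ∈ S then some (⟨x.1, h⟩, x.2) else none := by
    unfold restrictMachine
    simp only
    cases M q T.head <;> rfl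
  cases hx : M q T.head with
  | none =>
    simp [TM0.step, tapeStep, hM, hx]
  | some x =>
    obtain ⟨q₂, s⟩ := x
    have hq₂ : q₂ ∈ S := hS.2 hx hq'
    have e : TM0.step M ⟨q, T⟩ = some ⟨q₂, match s with
      | TM0.Stmt.move d => T.move d
      | TM0.Stmt.write a => T.write a⟩ := by
      simp [TM0.step, hx]
      cases s <;> rfl
    rw [e]
    refine ⟨_, ?_, Relation.TransGen.single (b := TapeCfg.apply ⟨⟨q, hq'⟩, T.head, T.left.nth,
      T.right.nth⟩ (⟨q₂, hq₂⟩ : S) s) ?_⟩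
    · cases s with
      | move d =>
        cases d
        · refine ⟨rfl, ?_, ?_, ?_⟩
          · simp [Tape.move, TapeCfg.apply]
          · funext p
            simp [Tape.move, TapeCfg.apply, ListBlank.nth_succ]
          · simp [Tape.move, TapeCfg.apply, nth_cons_eq_push]
        · refine ⟨rfl, ?_, ?_, ?_⟩
          · simp [Tape.move, TapeCfg.apply]
          · simp [Tape.move, TapeCfg.apply, nth_cons_eq_push]
          · funext p
            simp [Tape.move, TapeCfg.apply, ListBlank.nth_succ]
      | write a => exact ⟨rfl, rfl, rfl, rfl⟩
    · simp [tapeStep, hM, hx, hq₂]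

/-- Some machine has an undecidable halting problem. -/
theorem exists_undecidable_machine : ∃ T : Machine, ¬ ComputablePred T.Halts := by
  classical
  obtain ⟨c, hc⟩ := exists_code_undecidable
  let : Fintype PartrecToTM2.K' := ⟨{.main, .rev, .aux, .stack}, fun x => by cases x <;> simp⟩
  let iΛ : Inhabited PartrecToTM2.Λ' := ⟨PartrecToTM2.trNormal c PartrecToTM2.Cont'.halt⟩
  let M₂ : PartrecToTM2.Λ' →
      TM2.Stmt (fun _ : PartrecToTM2.K' => PartrecToTM2.Γ') PartrecToTM2.Λ'
        (Option PartrecToTM2.Γ') := PartrecToTM2.tr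
  let M₁ := TM2to1.tr M₂
  let M₀ := TM1to0.tr M₁
  let S₂ := PartrecToTM2.codeSupp c PartrecToTM2.Cont'.halt
  have hS₂ : TM2.Supports M₂ S₂ := PartrecToTM2.tr_supports c _
  let S₁ := TM2to1.trSupp M₂ S₂
  have hS₁ : TM1.Supports M₁ S₁ := TM2to1.tr_supports _ hS₂
  let S₀ := TM1to0.trStmts M₁ S₁
  have hS₀ : TM0.Supports M₀ S₀ := TM1to0.tr_supports M₁ hS₁
  let Γ := TM2to1.Γ' PartrecToTM2.K' (fun _ => PartrecToTM2.Γ')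
  let sym (a : PartrecToTM2.Γ') : Γ :=
    (false, Function.update (fun _ => none) PartrecToTM2.K'.main (some a))
  let T : Machine :=
    { Q := S₀
      Γ := Γ
      M := restrictMachine M₀ S₀
      start := ⟨default, hS₀.1⟩
      blank := default
      mark := (true, (sym PartrecToTM2.Γ'.cons).2)
      b₀ := sym PartrecToTM2.Γ'.bit0
      b₁ := sym PartrecToTM2.Γ'.bit1 }
  refine ⟨T, ?_⟩
  have key : T.Halts = fun m => (c.eval [2 ^ m]).Dom := by
    funext m
    apply propext
    have e₂ : (c.eval [2 ^ m]).Dom ↔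
        (TM2.eval M₂ PartrecToTM2.K'.main (PartrecToTM2.trList [2 ^ m])).Dom := by
      have h := PartrecToTM2.tr_eval c [2 ^ m]
      have hi : (TM2.init PartrecToTM2.K'.main (PartrecToTM2.trList [2 ^ m]) :
          TM2.Cfg (fun _ : PartrecToTM2.K' => PartrecToTM2.Γ') PartrecToTM2.Λ'
            (Option PartrecToTM2.Γ')) = PartrecToTM2.init c [2 ^ m] := by
        unfold TM2.init PartrecToTM2.init
        congr 1
        funext k
        cases k <;> rfl
      unfold TM2.eval
      rw [hi]
      change _ ↔ (StateTransition.eval (TM2.step PartrecToTM2.tr)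
        (PartrecToTM2.init c [2 ^ m])).Dom
      rw [h]
      rfl
    rw [e₂, ← TM2to1.tr_eval_dom M₂, ← TM1to0.tr_eval M₁]
    have hin : TM2to1.trInit PartrecToTM2.K'.main (PartrecToTM2.trList [2 ^ m]) =
        (true, (sym PartrecToTM2.Γ'.cons).2) :: sym PartrecToTM2.Γ'.bit1 ::
          List.replicate m (sym PartrecToTM2.Γ'.bit0) := by
      have hr : (PartrecToTM2.trList [2 ^ m]).reverse = PartrecToTM2.Γ'.cons ::
          PartrecToTM2.Γ'.bit1 :: List.replicate m PartrecToTM2.Γ'.bit0 := by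
        simp [trNat_two_pow]
      unfold TM2to1.trInit
      rw [hr]
      change _ :: _ :: List.map sym (List.replicate m _) = _
      rw [List.map_replicate]
      rfl
    rw [hin]
    symm
    have hinit : TracksCfg S₀ (TM0.init ((true, (sym PartrecToTM2.Γ'.cons).2) ::
        sym PartrecToTM2.Γ'.bit1 :: List.replicate m (sym PartrecToTM2.Γ'.bit0))) (T.init m) := by
      refine ⟨rfl, rfl, ?_, ?_⟩
      · funext p
        simp only [TM0.init, Machine.init]
        cases p <;> rfl
      · funext p
        simp only [TM0.init, Machine.init, Tape.mk₁, Tape.mk₂, Tape.mk'_right, ListBlank.tail_mk,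
          ListBlank.nth_mk, List.tail_cons]
        exact congrFun (getI_cons_replicate m (sym PartrecToTM2.Γ'.bit0)
          (sym PartrecToTM2.Γ'.bit1)) p
    exact (StateTransition.tr_eval_dom (respects_restrictMachine M₀ S₀ hS₀) hinit).symm
  rwa [key]

/-! ### The acceptance game of a universal automaton -/

/-- A universal automaton in explicit form. For a state, a letter, and the information whether the
clock exceeds `1`, the transition function gives `none` for `⊥`, and otherwise the list of the
configurations from which Adam chooses (`true` for "reset"). The state `wait` is the only one of
rank `1`; it waits for a letter in `acc`. -/
structure UnivSpec (S L : Type) where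
  delta : S → L → Bool → Option (List (S × Bool))
  start : S
  wait : S
  acc : L → Prop
  delta_wait_of_acc : ∀ a b, acc a → delta wait a b = some []
  delta_wait_of_not_acc : ∀ a b, ¬ acc a → delta wait a b = some [(wait, false)]

/-- The conjunction of a list of atoms. -/
def conjFormula : List (ℕ × Bool) → Formula
  | [] => .top
  | x :: l => .and (.atom x.1 x.2) (conjFormula l)

/-- The formula for a value of `UnivSpec.delta`. -/
def targetFormula {S : Type} (code : S → ℕ) : Option (List (S × Bool)) → Formula
  | none => .bot
  | some l => conjFormula (l.map fun x => (code x.1, x.2))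

/-- The constraint `x > 1`, or its negation. -/
def guardOf : Bool → Guard
  | true => [(Cmp.gt, 1)]
  | false => [(Cmp.le, 1)]

theorem guardOf_sat (b : Bool) (v : ℝ) : (guardOf b).Sat v ↔ b = decide (1 < v) := by
  cases b <;> simp [guardOf, Guard.Sat, Cmp.holds]

/-- The automaton `A` implements `U`: the numberings of states and letters are `code` and `lcode`,
and only the states in `V` are present in `A`. -/
structure Implements {S L : Type} (A : Automaton) (U : UnivSpec S L) (code : S → ℕ) (lcode : L → ℕ)
    (V : S → Prop) : Prop where
  start : A.start = code U.start
  code_inj : Function.Injective code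
  start_mem : V U.start
  delta_mem : ∀ s a b l, V s → U.delta s a b = some l → ∀ x ∈ l, V x.1
  mem_rules : ∀ s a b, V s →
    (⟨code s, lcode a, guardOf b, targetFormula code (U.delta s a b)⟩ : Rule) ∈ A.rules
  of_mem_rules : ∀ r ∈ A.rules, ∀ s a, V s → r.state = code s → r.letter = lcode a →
    ∃ b, r.guard = guardOf b ∧ r.target = targetFormula code (U.delta s a b)
  rank_wait : A.rank (code U.wait) = 1
  rank_other : ∀ s, V s → s ≠ U.wait → A.rank (code s) = 2

/-- The configurations that Adam can reach on the word with letters `a` and delays `d`. -/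
inductive Reach {S L : Type} (U : UnivSpec S L) (a : ℕ → L) (d : ℕ → ℝ) : ℕ → S → ℝ → Prop
  | start : Reach U a d 0 U.start 0
  | step (k : ℕ) (s : S) (v : ℝ) (l : List (S × Bool)) (x : S × Bool) (h : Reach U a d k s v)
      (hl : U.delta s (a k) (decide (1 < v + d k)) = some l) (hx : x ∈ l) :
      Reach U a d (k + 1) x.1 (if x.2 then 0 else v + d k)

section Game

variable {S L : Type} {A : Automaton} {U : UnivSpec S L} {code : S → ℕ} {lcode : L → ℕ}
  {V : S → Prop} {w : TimedWord A.numLetters} {a : ℕ → L}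

theorem Reach.mem {d : ℕ → ℝ} (hA : Implements A U code lcode V) {k : ℕ} {s : S} {v : ℝ}
    (h : Reach U a d k s v) : V s := by
  induction h with
  | start => exact hA.start_mem
  | step k s v l x _ hl hx ih => exact hA.delta_mem _ _ _ _ ih hl x hx

/-- What holds at each position of a play. -/
def PosReach (U : UnivSpec S L) (code : S → ℕ) (a : ℕ → L) (d : ℕ → ℝ) : Pos → Prop
  | .conf k q v => ∃ s, q = code s ∧ Reach U a d k s v
  | .form k _ v b => ∃ s v₀, Reach U a d k s v₀ ∧ v = v₀ + d k ∧
      ((U.delta s (a k) (decide (1 < v)) = none ∧ b = .bot) ∨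
      ∃ l, U.delta s (a k) (decide (1 < v)) = some l ∧
        ((∃ l', l' ⊆ l ∧ b = conjFormula (l'.map fun x => (code x.1, x.2))) ∨
        ∃ x ∈ l, b = .atom (code x.1) x.2))

theorem PosReach.move (hA : Implements A U code lcode V) (ha : ∀ i, w.letter i = lcode (a i))
    {p p' : Pos} (hp : PosReach U code a w.delay p) (hm : Move A w p p') :
    PosReach U code a w.delay p' := by
  cases hm with
  | read k q v r hr hq hl hv =>
    obtain ⟨s, rfl, hs⟩ := hp
    obtain ⟨b, hg, ht⟩ := hA.of_mem_rules r hr s (a k) (hs.mem hA) hq (hl.trans (ha k))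
    rw [hg, guardOf_sat] at hv
    subst hv
    refine ⟨s, v, hs, rfl, ?_⟩
    rw [ht]
    cases hd : U.delta s (a k) (decide (1 < v + w.delay k)) with
    | none => exact Or.inl ⟨rfl, rfl⟩
    | some l => exact Or.inr ⟨l, rfl, Or.inl ⟨l, List.Subset.refl l, rfl⟩⟩
  | andLeft k q v b c =>
    obtain ⟨s, v₀, hs, hv, ⟨_, h⟩ | ⟨l, hl, ⟨l', hsub, h⟩ | ⟨x, hx, h⟩⟩⟩ := hp
    · cases h
    · cases l' with
      | nil => cases h
      | cons x l' =>
        cases h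
        exact ⟨s, v₀, hs, hv, Or.inr ⟨l, hl, Or.inr ⟨x, hsub (by simp), rfl⟩⟩⟩
    · cases h
  | andRight k q v b c =>
    obtain ⟨s, v₀, hs, hv, ⟨_, h⟩ | ⟨l, hl, ⟨l', hsub, h⟩ | ⟨x, hx, h⟩⟩⟩ := hp
    · cases h
    · cases l' with
      | nil => cases h
      | cons x l' =>
        cases h
        exact ⟨s, v₀, hs, hv, Or.inr ⟨l, hl, Or.inl ⟨l', fun y hy => hsub (by simp [hy]), rfl⟩⟩⟩
    · cases h
  | orLeft k q v b c | orRight k q v b c =>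
    obtain ⟨s, v₀, hs, hv, ⟨_, h⟩ | ⟨l, hl, ⟨l', hsub, h⟩ | ⟨x, hx, h⟩⟩⟩ := hp
    · cases h
    · cases l' <;> cases h
    · cases h
  | keep k q v p =>
    obtain ⟨s, v₀, hs, hv, ⟨_, h⟩ | ⟨l, hl, ⟨l', hsub, h⟩ | ⟨x, hx, h⟩⟩⟩ := hp
    · cases h
    · cases l' <;> cases h
    · obtain ⟨y, f⟩ := x
      cases h
      subst hv
      exact ⟨y, rfl, Reach.step k s v₀ l _ hs hl hx⟩
  | reset k q v p =>
    obtain ⟨s, v₀, hs, hv, ⟨_, h⟩ | ⟨l, hl, ⟨l', hsub, h⟩ | ⟨x, hx, h⟩⟩⟩ := hp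
    · cases h
    · cases l' <;> cases h
    · obtain ⟨y, f⟩ := x
      cases h
      subst hv
      exact ⟨y, rfl, Reach.step k s v₀ l _ hs hl hx⟩

theorem Respects.posReach (hA : Implements A U code lcode V) (ha : ∀ i, w.letter i = lcode (a i))
    {σ : Strategy A w} {h : List Pos} (hh : Respects σ h) : ∀ p ∈ h.head?,
    PosReach U code a w.delay p := by
  induction hh with
  | start =>
    intro p hp
    cases hp
    exact ⟨U.start, hA.start, Reach.start⟩
  | step p p' h _ hm _ ih =>
    intro p₁ hp₁
    cases hp₁
    exact (ih p rfl).move hA ha hm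

theorem PosReach.not_isEve {d : ℕ → ℝ} {p : Pos} (hp : PosReach U code a d p) : ¬ p.IsEve := by
  intro he
  cases p with
  | conf k q v => exact he
  | form k q v b =>
    cases b with
    | or b c =>
      obtain ⟨s, v₀, hs, hv, ⟨_, h⟩ | ⟨l, hl, ⟨l', hsub, h⟩ | ⟨x, hx, h⟩⟩⟩ := hp
      · cases h
      · cases l' <;> cases h
      · cases h
    | _ => exact he

theorem Respects.extend (hA : Implements A U code lcode V) (ha : ∀ i, w.letter i = lcode (a i))
    {σ : Strategy A w} {p p' : Pos} {h : List Pos} (hh : Respects σ (p :: h))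
    (hm : Move A w p p') : Respects σ (p' :: p :: h) :=
  Respects.step p p' h hh hm fun he => absurd he (hh.posReach hA ha p rfl).not_isEve

theorem Respects.conj (hA : Implements A U code lcode V) (ha : ∀ i, w.letter i = lcode (a i))
    {σ : Strategy A w} {k q : ℕ} {v : ℝ} {x : ℕ × Bool} :
    ∀ {l : List (ℕ × Bool)} {h : List Pos}, x ∈ l →
      Respects σ (.form k q v (conjFormula l) :: h) →
      ∃ h', Respects σ (.conf (k + 1) x.1 (if x.2 then 0 else v) :: h')
  | y :: l, h, hx, hh => by
    rcases List.mem_cons.1 hx with rfl | hx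
    · have h₁ := hh.extend hA ha (Move.andLeft k q v _ _)
      obtain ⟨p, f⟩ := x
      cases f
      · exact ⟨_, h₁.extend hA ha (Move.keep k q v p)⟩
      · exact ⟨_, h₁.extend hA ha (Move.reset k q v p)⟩
    · exact Respects.conj hA ha hx (hh.extend hA ha (Move.andRight k q v _ _))

theorem move_read (hA : Implements A U code lcode V) (ha : ∀ i, w.letter i = lcode (a i))
    {k : ℕ} {s : S} (hs : V s) (v : ℝ) :
    Move A w (.conf k (code s) v) (.form k (code s) (v + w.delay k)
      (targetFormula code (U.delta s (a k) (decide (1 < v + w.delay k))))) :=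
  Move.read k (code s) v ⟨code s, lcode (a k), guardOf (decide (1 < v + w.delay k)), _⟩
    (hA.mem_rules s (a k) _ hs) rfl (ha k).symm ((guardOf_sat _ _).2 rfl)

theorem Reach.exists_respects (hA : Implements A U code lcode V)
    (ha : ∀ i, w.letter i = lcode (a i)) (σ : Strategy A w) {k : ℕ} {s : S} {v : ℝ}
    (h : Reach U a w.delay k s v) : ∃ h, Respects σ (.conf k (code s) v :: h) := by
  induction h with
  | start => exact ⟨[], hA.start ▸ Respects.start⟩
  | step k s v l x h hl hx ih =>
    obtain ⟨h', hh'⟩ := ih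
    have h₁ := hh'.extend hA ha (move_read hA ha (h.mem hA) v)
    rw [hl] at h₁
    exact Respects.conj hA ha (x := (code x.1, x.2)) (List.mem_map.2 ⟨x, hx, rfl⟩) h₁

theorem history_succ (π : ℕ → Pos) (n : ℕ) : history π (n + 1) = π (n + 1) :: history π n := by
  simp [history, List.range_succ]

theorem exists_history (π : ℕ → Pos) (n : ℕ) : ∃ h, history π n = π n :: h := by
  cases n with
  | zero => exact ⟨[], rfl⟩
  | succ n => exact ⟨_, history_succ π n⟩

theorem Respects.move_of_history {σ : Strategy A w} {π : ℕ → Pos}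
    (hπ : ∀ n, Respects σ (history π n)) (n : ℕ) : Move A w (π n) (π (n + 1)) := by
  have h := hπ (n + 1)
  rw [history_succ] at h
  obtain ⟨h', e⟩ := exists_history π n
  rw [e] at h
  generalize hl : π (n + 1) :: π n :: h' = l at h
  cases h with
  | start => simp at hl
  | step _ _ _ _ hm _ =>
    cases hl
    exact hm

/-- A finite play that respects a strategy continues to an infinite one that follows any given
sequence of moves. -/
theorem Respects.exists_play (hA : Implements A U code lcode V)
    (ha : ∀ i, w.letter i = lcode (a i)) {σ : Strategy A w} {ρ : ℕ → Pos}
    (hρ : ∀ n, Move A w (ρ n) (ρ (n + 1))) {h : List Pos} (hh : Respects σ (ρ 0 :: h)) :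
    ∃ π : ℕ → Pos, (∀ n, Respects σ (history π n)) ∧ ∃ n, π n = ρ 0 := by
  suffices H : ∀ (h : List Pos) (ρ : ℕ → Pos), (∀ n, Move A w (ρ n) (ρ (n + 1))) →
      Respects σ (ρ 0 :: h) → ∃ π : ℕ → Pos, (∀ n, Respects σ (history π n)) ∧
        ∀ n, π (h.length + n) = ρ n by
    obtain ⟨π, h₁, h₂⟩ := H h ρ hρ hh
    exact ⟨π, h₁, _, h₂ 0⟩
  clear hh h hρ ρ
  intro h
  induction h with
  | nil =>
    intro ρ hρ hh
    refine ⟨ρ, fun n => ?_, fun n => by simp⟩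
    induction n with
    | zero => exact hh
    | succ n ih =>
      obtain ⟨h', e⟩ := exists_history ρ n
      rw [history_succ, e]
      rw [e] at ih
      exact ih.extend hA ha (hρ n)
  | cons p h ih =>
    intro ρ hρ hh
    generalize hl : ρ 0 :: p :: h = l at hh
    cases hh with
    | start => simp at hl
    | step _ p' _ hp hm he =>
      cases hl
      obtain ⟨π, h₁, h₂⟩ := ih (fun n => n.casesOn p fun n => ρ n)
        (fun n => by
          cases n with
          | zero => exact hm
          | succ n => exact hρ n) hp
      refine ⟨π, h₁, fun n => ?_⟩
      have := h₂ (n + 1)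
      rw [List.length_cons, add_assoc, add_comm 1 n]
      exact this

/-- If Adam can reach `wait`, and no letter of `acc` is to come, then each strategy of Eve loses. -/
theorem Strategy.Winning.exists_acc (hA : Implements A U code lcode V)
    (ha : ∀ i, w.letter i = lcode (a i)) {σ : Strategy A w} (hσ : σ.Winning) {k : ℕ} {v : ℝ}
    (hk : Reach U a w.delay k U.wait v) : ∃ j ≥ k, U.acc (a j) := by
  by_contra! hno
  have hV : V U.wait := hk.mem hA
  obtain ⟨h, hh⟩ := hk.exists_respects hA ha σ
  let P : Pos → Prop := fun p => ∃ j ≥ k, ∃ v, p = .conf j (code U.wait) v ∨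
    p = .form j (code U.wait) v (conjFormula [(code U.wait, false)]) ∨
    p = .form j (code U.wait) v (.atom (code U.wait) false)
  have hP : ∀ p : {p // P p}, ∃ p' : {p // P p}, Move A w p.1 p'.1 := by
    rintro ⟨p, j, hj, v, rfl | rfl | rfl⟩
    · have hm := move_read hA ha (k := j) hV v
      rw [U.delta_wait_of_not_acc _ _ (hno j hj)] at hm
      exact ⟨⟨_, j, hj, _, Or.inr (Or.inl rfl)⟩, hm⟩
    · exact ⟨⟨_, j, hj, v, Or.inr (Or.inr rfl)⟩, Move.andLeft _ _ _ _ _⟩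
    · exact ⟨⟨_, j + 1, by omega, v, Or.inl rfl⟩, Move.keep _ _ _ _⟩
  choose f hf using hP
  let ρ : ℕ → {p // P p} := fun n => f^[n] ⟨.conf k (code U.wait) v, k, le_rfl, v, Or.inl rfl⟩
  obtain ⟨π, hπ, n, hn⟩ := Respects.exists_play hA ha (σ := σ) (ρ := fun n => (ρ n).1) (h := h)
    (fun n => by
      simp only [ρ, Function.iterate_succ_apply']
      exact hf _) hh
  have hpar := hσ.2 π hπ
  unfold WeakParity at hpar
  have h1 : sInf {r | ∃ n k q v, π n = .conf k q v ∧ A.rank q = r} = 1 := by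
    apply le_antisymm
    · exact Nat.sInf_le ⟨n, k, code U.wait, v, hn, hA.rank_wait⟩
    · refine le_csInf ⟨1, n, k, code U.wait, v, hn, hA.rank_wait⟩ ?_
      rintro r ⟨n, k', q, v', hq, rfl⟩
      obtain ⟨h', e⟩ := exists_history π n
      have hr := hπ n
      rw [e] at hr
      have hp := hr.posReach hA ha _ rfl
      rw [hq] at hp
      obtain ⟨s, rfl, hs⟩ := hp
      by_cases hsw : s = U.wait
      · rw [hsw, hA.rank_wait]
      · rw [hA.rank_other s (hs.mem hA) hsw]
        norm_num
  rw [h1] at hpar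
  exact absurd hpar (by decide)

/-- A winning strategy keeps Adam from `⊥`. -/
theorem Strategy.Winning.delta_ne_none (hA : Implements A U code lcode V)
    (ha : ∀ i, w.letter i = lcode (a i)) {σ : Strategy A w} (hσ : σ.Winning) {k : ℕ} {s : S}
    {v : ℝ} (hk : Reach U a w.delay k s v) :
    U.delta s (a k) (decide (1 < v + w.delay k)) ≠ none := by
  intro hd
  obtain ⟨h, hh⟩ := hk.exists_respects hA ha σ
  have h₁ := hh.extend hA ha (move_read hA ha (hk.mem hA) v)
  rw [hd] at h₁
  exact hσ.1 _ _ h₁ (fun p' hm => by cases hm)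

/-- Eve wins if Adam cannot reach `⊥`, nor wait forever. -/
theorem accepts_of_reach (hA : Implements A U code lcode V) (ha : ∀ i, w.letter i = lcode (a i))
    (hbot : ∀ k s v, Reach U a w.delay k s v →
      U.delta s (a k) (decide (1 < v + w.delay k)) ≠ none)
    (hacc : ∀ k v, Reach U a w.delay k U.wait v → ∃ j ≥ k, U.acc (a j)) : A.Accepts w := by
  let σ : Strategy A w :=
    { next := fun h => match h with
        | .form k q v (.or b _) :: _ => .form k q v b
        | _ => .conf 0 0 0
      legal := fun p h hp => by
        cases p with
        | conf k q v => exact hp.elim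
        | form k q v b =>
          cases b with
          | or b c => exact Move.orLeft k q v b c
          | _ => exact hp.elim }
  refine ⟨σ, ?_, ?_⟩
  · intro p h hh hno
    have hp := hh.posReach hA ha p rfl
    cases p with
    | conf k q v =>
      obtain ⟨s, rfl, hs⟩ := hp
      exact (hno _ (move_read hA ha (hs.mem hA) v)).elim
    | form k q v b =>
      obtain ⟨s, v₀, hs, rfl, ⟨hd, _⟩ | ⟨l, hl, ⟨l', hsub, rfl⟩ | ⟨⟨y, f⟩, hx, rfl⟩⟩⟩ := hp
      · exact (hbot _ _ _ hs hd).elim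
      · cases l' with
        | nil => trivial
        | cons x l' => exact (hno _ (Move.andLeft _ _ _ _ _)).elim
      · cases f
        · exact (hno _ (Move.keep _ _ _ _)).elim
        · exact (hno _ (Move.reset _ _ _ _)).elim
  · intro π hπ
    have hmove := fun n => Respects.move_of_history hπ n
    have hreach : ∀ n, PosReach U code a w.delay (π n) := by
      intro n
      obtain ⟨h', e⟩ := exists_history π n
      exact (hπ n).posReach hA ha _ (by rw [e]; rfl)
    have hreachw : ∀ n k v, π n = .conf k (code U.wait) v → Reach U a w.delay k U.wait v := by
      intro n k v hn
      have h := hreach n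
      rw [hn] at h
      obtain ⟨s, hs, h⟩ := h
      exact hA.code_inj hs ▸ h
    have hstep : ∀ n k v, π n = .conf k (code U.wait) v →
        ¬ U.acc (a k) ∧ ∃ n' v', π n' = .conf (k + 1) (code U.wait) v' := by
      intro n k v hn
      have hV : V U.wait := (hreachw n k v hn).mem hA
      have h₁ := hmove n
      have h₂ := hmove (n + 1)
      have h₃ := hmove (n + 2)
      rw [hn] at h₁
      generalize π (n + 1) = p₁ at h₁ h₂
      cases h₁ with
      | read _ _ _ r hr hq hl hv =>
        obtain ⟨b, -, ht⟩ := hA.of_mem_rules r hr U.wait (a k) hV hq (hl.trans (ha k))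
        rw [ht] at h₂
        by_cases hk : U.acc (a k)
        · rw [U.delta_wait_of_acc _ _ hk] at h₂
          cases h₂
        · rw [U.delta_wait_of_not_acc _ _ hk] at h₂
          refine ⟨hk, n + 3, v + w.delay k, ?_⟩
          change Move A w (.form k _ _ (.and (.atom _ false) .top)) _ at h₂
          change Move A w (π (n + 2)) (π (n + 3)) at h₃
          generalize π (n + 3) = p₃ at h₃
          generalize π (n + 1 + 1) = p₂ at h₂ h₃
          cases h₂ with
          | andLeft =>
            cases h₃
            rfl
          | andRight => cases h₃
    have hnowait : ∀ n k v, π n ≠ .conf k (code U.wait) v := by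
      intro n k v hn
      obtain ⟨j, hj, hacc⟩ := hacc k v (hreachw n k v hn)
      obtain ⟨i, rfl⟩ := Nat.exists_eq_add_of_le hj
      clear hj
      induction i generalizing n k v with
      | zero => exact (hstep n k v hn).1 hacc
      | succ i ih =>
        obtain ⟨-, n', v', hn'⟩ := hstep n k v hn
        exact ih n' (k + 1) v' hn' (by rwa [add_right_comm, add_assoc])
    have hset : {r | ∃ n k q v, π n = .conf k q v ∧ A.rank q = r} = {2} := by
      ext r
      constructor
      · rintro ⟨n, k, q, v, hn, rfl⟩
        have h := hreach n
        rw [hn] at h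
        obtain ⟨s, rfl, hs⟩ := h
        exact hA.rank_other s (hs.mem hA) fun hw => hnowait n k v (hw ▸ hn)
      · rintro rfl
        have h₀ : π 0 = .conf 0 A.start 0 := by
          have h := hπ 0
          generalize hl : history π 0 = l at h
          cases h with
          | start =>
            have : [π 0] = [Pos.conf 0 A.start 0] := hl
            simpa using this
          | step => cases hl
        refine ⟨0, 0, A.start, 0, h₀, ?_⟩
        rw [hA.start]
        refine hA.rank_other _ hA.start_mem fun hw => hnowait 0 0 0 ?_
        rw [h₀, hA.start, hw]
    unfold WeakParity
    rw [hset, csInf_singleton]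
    decide

end Game

/-! ### Conditions on timed words, and the universal automaton that tests them -/

/-- Conditions on timed words over `L` that can be tested by the automata in question. See
`StreamSpec.Stream` for their meaning. -/
structure StreamSpec (L Γ : Type) where
  first : L → Prop
  adj : L → L → Prop
  mtch : L → L → L → Prop
  hdr : L → Prop
  acc : L → Prop
  chk : L → Prop
  val : L → Option Γ

/-- The word with letters `ℓ` at times `t` meets the conditions `X`. The last letter in the window
of length `1` that follows the letter number `i` is its *image*: `image` relates the letter to its
image and to the letter after this, and no letter strictly between a header and its image is
a header. The letters with a value that follow a letter in `chk` have the values `e 0, e 1, …`. -/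
structure StreamSpec.Stream {L Γ : Type} (X : StreamSpec L Γ) (e : ℕ → Γ) (ℓ : ℕ → L) (t : ℕ → ℝ) :
    Prop where
  first : X.first (ℓ 0)
  adj : ∀ i, X.adj (ℓ i) (ℓ (i + 1))
  image : ∀ i j, i < j → t j ≤ t i + 1 → t i + 1 < t (j + 1) → X.mtch (ℓ i) (ℓ j) (ℓ (j + 1))
  next_le : ∀ i, t (i + 1) ≤ t i + 1
  hdr : ∀ i j, i < j → t (j + 1) ≤ t i + 1 → X.hdr (ℓ i) → ¬ X.hdr (ℓ j)
  acc : ∀ k, ∃ j ≥ k, X.acc (ℓ j)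
  chk : ∀ i, X.chk (ℓ i) → ∀ n, (∀ r < n, X.val (ℓ (i + 1 + r)) ≠ none) →
    ∀ g, X.val (ℓ (i + 1 + n)) = some g → g = e n

/-- The states that do not depend on the input: `main p` when the last letter was `p`,
`copy a p` when the clock measures the time since the letter `a` and the last letter after it was
`p`, and `wait` when a letter from `acc` must come. -/
inductive FixedState (L : Type)
  | main (p : Option L)
  | copy (a : L) (p : Option L)
  | wait

/-- All states; `Sum.inr k` expects the value number `k` of the input. -/
abbrev StreamState (L : Type) := FixedState L ⊕ ℕ

/-- The delays of a sequence of time stamps. -/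
def delayOf (t : ℕ → ℝ) : ℕ → ℝ
  | 0 => t 0
  | k + 1 => t (k + 1) - t k

namespace StreamSpec

variable {L Γ : Type} (X : StreamSpec L Γ)

/-- Whether a letter may follow the last one. -/
def Good : Option L → L → Prop
  | none, a => X.first a
  | some p, a => X.adj p a

open scoped Classical in
/-- The transitions from the states that do not depend on the input. -/
noncomputable def fixedDelta : FixedState L → L → Bool → Option (List (StreamState L × Bool))
  | .main p, a, _ =>
    if X.Good p a then
      some ((.inl (.main (some a)), false) :: (.inl (.copy a none), true) ::
        (.inl .wait, false) :: if X.chk a then [(.inr 0, false)] else [])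
    else none
  | .copy b p, a, false =>
    if ∃ c, p = some c ∧ X.hdr b ∧ X.hdr c then none else some [(.inl (.copy b (some a)), false)]
  | .copy b p, a, true => if ∃ c, p = some c ∧ X.mtch b c a then some [] else none
  | .wait, a, _ => if X.acc a then some [] else some [(.inl .wait, false)]

open scoped Classical in
/-- The transitions from the states that test the input. The values `e (m + 1)`, `e (m + 2)`, …
are all tested in the state `m + 1`. -/
noncomputable def checkDelta (e : ℕ → Γ) (m k : ℕ) (a : L) : Option (List (StreamState L × Bool)) :=
  match X.val a with
  | none => some []
  | some g => if g = e k then some [(.inr (if k ≤ m then k + 1 else k), false)] else none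

/-- The universal automaton that tests the conditions `X`. -/
noncomputable def univSpec (e : ℕ → Γ) (m : ℕ) : UnivSpec (StreamState L) L where
  delta s a b := match s with
    | .inl s => X.fixedDelta s a b
    | .inr k => X.checkDelta e m k a
  start := .inl (.main none)
  wait := .inl .wait
  acc := X.acc
  delta_wait_of_acc a b h := by simp [fixedDelta, h]
  delta_wait_of_not_acc a b h := by simp [fixedDelta, h]

variable {X} {e : ℕ → Γ} {m : ℕ} {ℓ : ℕ → L} {t : ℕ → ℝ}

/-- What is known about the configurations that Adam can reach on a word that meets
the conditions. -/
def Reachable (X : StreamSpec L Γ) (m : ℕ) (ℓ : ℕ → L) (t : ℕ → ℝ) (k : ℕ) :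
    StreamState L → ℝ → Prop
  | .inl (.main p), _ => (k = 0 ∧ p = none) ∨ ∃ i, k = i + 1 ∧ p = some (ℓ i)
  | .inl (.copy b p), v => ∃ i n, k = i + n + 1 ∧ b = ℓ i ∧ v = t (i + n) - t i ∧
      t (i + n) ≤ t i + 1 ∧ p = if n = 0 then none else some (ℓ (i + n))
  | .inl .wait, _ => True
  | .inr c, _ => ∃ i n, k = i + 1 + n ∧ X.chk (ℓ i) ∧ c = min n (m + 1) ∧
      ∀ r < n, X.val (ℓ (i + 1 + r)) ≠ none

theorem Stream.delta_eq_some (h : X.Stream e ℓ t) (he : ∀ n > m, e n = e (m + 1)) {k : ℕ}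
    {s : StreamState L} {v : ℝ} (hs : Reachable X m ℓ t k s v) :
    ∃ l, (X.univSpec e m).delta s (ℓ k) (decide (1 < v + delayOf t k)) = some l ∧
      ∀ x ∈ l, Reachable X m ℓ t (k + 1) x.1 (if x.2 then 0 else v + delayOf t k) := by
  match s with
  | .inl (.main p) =>
    have hg : X.Good p (ℓ k) := by
      rcases hs with ⟨rfl, rfl⟩ | ⟨i, rfl, rfl⟩
      · exact h.first
      · exact h.adj i
    refine ⟨_, by simp only [univSpec, fixedDelta, if_pos hg]; rfl, ?_⟩
    intro x hx
    simp only [List.mem_cons] at hx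
    rcases hx with rfl | rfl | rfl | hx
    · exact Or.inr ⟨k, rfl, rfl⟩
    · exact ⟨k, 0, rfl, rfl, by simp, by simp, rfl⟩
    · trivial
    · split_ifs at hx with hc
      · rw [List.mem_singleton] at hx
        subst hx
        exact ⟨k, 0, rfl, hc, by simp, by simp⟩
      · simp at hx
  | .inl (.copy b p) =>
    obtain ⟨i, n, rfl, rfl, rfl, hle, rfl⟩ := hs
    have hv : t (i + n) - t i + delayOf t (i + n + 1) = t (i + n + 1) - t i := by
      simp [delayOf]
    rw [hv]
    by_cases hb : t (i + n + 1) ≤ t i + 1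
    · rw [decide_eq_false (by linarith)]
      refine ⟨[(.inl (.copy (ℓ i) (some (ℓ (i + n + 1)))), false)], ?_, ?_⟩
      · simp only [univSpec, fixedDelta]
        rw [if_neg]
        rintro ⟨c, hc, h₁, h₂⟩
        split_ifs at hc with hn
        cases hc
        exact h.hdr i (i + n) (by omega) hb h₁ h₂
      · intro x hx
        rw [List.mem_singleton] at hx
        subst hx
        exact ⟨i, n + 1, rfl, rfl, rfl, hb, rfl⟩
    · rw [decide_eq_true (by linarith)]
      refine ⟨[], ?_, by simp⟩
      simp only [univSpec, fixedDelta]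
      have hn : n ≠ 0 := by
        rintro rfl
        exact hb (h.next_le i)
      exact if_pos ⟨ℓ (i + n), if_neg hn, h.image i (i + n) (by omega) hle (by linarith)⟩
  | .inl .wait =>
    by_cases ha : X.acc (ℓ k)
    · exact ⟨[], by simp [univSpec, fixedDelta, ha], by simp⟩
    · refine ⟨[(.inl .wait, false)], by simp [univSpec, fixedDelta, ha], ?_⟩
      intro x hx
      rw [List.mem_singleton] at hx
      subst hx
      trivial
  | .inr c =>
    obtain ⟨i, n, rfl, hc, rfl, hr⟩ := hs
    simp only [univSpec, checkDelta]
    cases hval : X.val (ℓ (i + 1 + n)) with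
    | none => exact ⟨[], rfl, by simp⟩
    | some g =>
      have hg : g = e (min n (m + 1)) := by
        rw [h.chk i hc n hr g hval]
        rcases le_or_gt n m with hn | hn
        · rw [min_eq_left (by omega)]
        · rw [min_eq_right (by omega), he n hn]
      refine ⟨_, if_pos hg, ?_⟩
      intro x hx
      rw [List.mem_singleton] at hx
      subst hx
      refine ⟨i, n + 1, rfl, hc, ?_, ?_⟩
      · split_ifs <;> omega
      · intro r hr'
        rcases Nat.lt_succ_iff_lt_or_eq.1 hr' with hr' | rfl
        · exact hr r hr'
        · rw [hval]
          simp

theorem Stream.reachable (h : X.Stream e ℓ t) (he : ∀ n > m, e n = e (m + 1)) {k : ℕ}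
    {s : StreamState L} {v : ℝ} (hs : Reach (X.univSpec e m) ℓ (delayOf t) k s v) :
    Reachable X m ℓ t k s v := by
  induction hs with
  | start => exact Or.inl ⟨rfl, rfl⟩
  | step k s v l x _ hl hx ih =>
    obtain ⟨l', hl', hx'⟩ := h.delta_eq_some he ih
    rw [hl] at hl'
    cases hl'
    exact hx' x hx

/-- Adam cannot reach `⊥`. -/
def Safe (X : StreamSpec L Γ) (e : ℕ → Γ) (m : ℕ) (ℓ : ℕ → L) (t : ℕ → ℝ) : Prop :=
  ∀ k s v, Reach (X.univSpec e m) ℓ (delayOf t) k s v →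
    (X.univSpec e m).delta s (ℓ k) (decide (1 < v + delayOf t k)) ≠ none

theorem good_of_reach (hbot : Safe X e m ℓ t) {k : ℕ} {p : Option L} {v : ℝ}
    (hs : Reach (X.univSpec e m) ℓ (delayOf t) k (.inl (.main p)) v) : X.Good p (ℓ k) := by
  by_contra hg
  exact hbot _ _ _ hs (by simp [univSpec, fixedDelta, hg])

theorem reach_of_mem_main (hbot : Safe X e m ℓ t) {k : ℕ} {p : Option L} {v : ℝ}
    (hs : Reach (X.univSpec e m) ℓ (delayOf t) k (.inl (.main p)) v) (x : StreamState L × Bool)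
    (hx : x = (.inl (.main (some (ℓ k))), false) ∨ x = (.inl (.copy (ℓ k) none), true) ∨
      x = (.inl .wait, false) ∨ X.chk (ℓ k) ∧ x = (.inr 0, false)) :
    Reach (X.univSpec e m) ℓ (delayOf t) (k + 1) x.1 (if x.2 then 0 else v + delayOf t k) := by
  refine Reach.step k _ v _ x hs (if_pos (good_of_reach hbot hs)) ?_
  rcases hx with rfl | rfl | rfl | ⟨hc, rfl⟩
  · simp
  · simp
  · simp
  · simp [hc]

theorem reach_main (hbot : Safe X e m ℓ t) : ∀ k, ∃ v, Reach (X.univSpec e m) ℓ (delayOf t) k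
    (.inl (.main (if k = 0 then none else some (ℓ (k - 1))))) v
  | 0 => ⟨0, Reach.start⟩
  | k + 1 => by
    obtain ⟨v, hv⟩ := reach_main hbot k
    exact ⟨_, reach_of_mem_main hbot hv _ (Or.inl rfl)⟩

theorem reach_copy (hbot : Safe X e m ℓ t) (ht : Monotone t) (i : ℕ) : ∀ n, t (i + n) ≤ t i + 1 →
    Reach (X.univSpec e m) ℓ (delayOf t) (i + n + 1)
      (.inl (.copy (ℓ i) (if n = 0 then none else some (ℓ (i + n))))) (t (i + n) - t i)
  | 0, _ => by
    obtain ⟨v, hv⟩ := reach_main hbot i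
    simpa using reach_of_mem_main hbot hv _ (Or.inr (Or.inl rfl))
  | n + 1, hn => by
    have ih := reach_copy hbot ht i n ((ht (by omega)).trans hn)
    have hv : t (i + n) - t i + delayOf t (i + n + 1) = t (i + n + 1) - t i := by
      simp [delayOf]
    have h₁ := hbot _ _ _ ih
    have hd : decide (1 < t (i + n) - t i + delayOf t (i + n + 1)) = false :=
      decide_eq_false (by rw [hv]; rw [← add_assoc] at hn; linarith)
    rw [hd] at h₁
    have h₂ := Reach.step (i + n + 1) _ _ [(.inl (.copy (ℓ i) (some (ℓ (i + n + 1)))), false)]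
      (.inl (.copy (ℓ i) (some (ℓ (i + n + 1)))), false) ih (by
        rw [hd]
        simp only [univSpec, fixedDelta] at h₁ ⊢
        exact if_neg fun hc => h₁ (if_pos hc)) (by simp)
    simp only [Bool.false_eq_true, if_false, hv] at h₂
    exact h₂

theorem reach_check (hbot : Safe X e m ℓ t) {i : ℕ} (hi : X.chk (ℓ i)) : ∀ n,
    (∀ r < n, X.val (ℓ (i + 1 + r)) ≠ none) →
    ∃ v, Reach (X.univSpec e m) ℓ (delayOf t) (i + 1 + n) (.inr (min n (m + 1))) v
  | 0, _ => by
    obtain ⟨v, hv⟩ := reach_main hbot i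
    simpa using ⟨_, reach_of_mem_main hbot hv _ (Or.inr (Or.inr (Or.inr ⟨hi, rfl⟩)))⟩
  | n + 1, hn => by
    obtain ⟨v, hv⟩ := reach_check hbot hi n fun r hr => hn r (by omega)
    obtain ⟨g, hg⟩ := Option.ne_none_iff_exists'.1 (hn n (by omega))
    have h₁ := hbot _ _ _ hv
    have hge : g = e (min n (m + 1)) := by
      by_contra hne
      exact h₁ (by simp only [univSpec, checkDelta, hg, if_neg hne])
    have h₂ := Reach.step _ _ _ [(.inr (if min n (m + 1) ≤ m then min n (m + 1) + 1 else
        min n (m + 1)), false)] _ hv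
      (by simp only [univSpec, checkDelta, hg, if_pos hge]) (List.mem_singleton.2 rfl)
    have hmin : (if min n (m + 1) ≤ m then min n (m + 1) + 1 else min n (m + 1)) =
        min (n + 1) (m + 1) := by
      split_ifs <;> omega
    rw [hmin] at h₂
    exact ⟨_, h₂⟩

/-- A word meets the conditions if Adam can reach neither `⊥`, nor wait forever. -/
theorem stream_of_reach (hbot : Safe X e m ℓ t) (ht : Monotone t) (he : ∀ n > m, e n = e (m + 1))
    (hacc : ∀ k v, Reach (X.univSpec e m) ℓ (delayOf t) k (.inl .wait) v →
      ∃ j ≥ k, X.acc (ℓ j)) : X.Stream e ℓ t where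
  first := by
    obtain ⟨v, hv⟩ := reach_main hbot 0
    exact good_of_reach hbot hv
  adj i := by
    obtain ⟨v, hv⟩ := reach_main hbot (i + 1)
    exact good_of_reach hbot hv
  image i j hij hj hj' := by
    obtain ⟨n, rfl⟩ := Nat.exists_eq_add_of_le hij.le
    have h := hbot _ _ _ (reach_copy hbot ht i n hj)
    have hv : t (i + n) - t i + delayOf t (i + n + 1) = t (i + n + 1) - t i := by
      simp [delayOf]
    rw [hv, decide_eq_true (by linarith)] at h
    by_contra hno
    refine h (if_neg ?_)
    rintro ⟨c, hc, hm⟩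
    rw [if_neg (by omega)] at hc
    cases hc
    exact hno hm
  next_le i := by
    by_contra hi
    have h := hbot _ _ _ (reach_copy hbot ht i 0 (by simp))
    have hv : t (i + 0) - t i + delayOf t (i + 0 + 1) = t (i + 1) - t i := by
      simp [delayOf]
    rw [hv, decide_eq_true (by linarith)] at h
    exact h (by simp [univSpec, fixedDelta])
  hdr i j hij hj h₁ h₂ := by
    obtain ⟨n, rfl⟩ := Nat.exists_eq_add_of_le hij.le
    have h := hbot _ _ _ (reach_copy hbot ht i n ((ht (by omega)).trans hj))
    have hv : t (i + n) - t i + delayOf t (i + n + 1) = t (i + n + 1) - t i := by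
      simp [delayOf]
    rw [hv, decide_eq_false (by linarith)] at h
    exact h (if_pos ⟨ℓ (i + n), if_neg (by omega), h₁, h₂⟩)
  acc k := by
    obtain ⟨v, hv⟩ := reach_main hbot k
    obtain ⟨j, hj, h⟩ := hacc _ _ (reach_of_mem_main hbot hv _ (Or.inr (Or.inr (Or.inl rfl))))
    exact ⟨j, by omega, h⟩
  chk i hi n hr g hg := by
    obtain ⟨v, hv⟩ := reach_check hbot hi n hr
    have hge : g = e (min n (m + 1)) := by
      by_contra hne
      exact hbot _ _ _ hv (by simp only [univSpec, checkDelta, hg, if_neg hne])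
    rw [hge]
    rcases le_or_gt n m with hn | hn
    · rw [min_eq_left (by omega)]
    · rw [min_eq_right (by omega), he n hn]

end StreamSpec

/-! ### The automaton as a finite object -/

theorem mem_states_conjFormula {l : List (ℕ × Bool)} {q : ℕ} (h : q ∈ (conjFormula l).states) :
    ∃ x ∈ l, x.1 = q := by
  induction l with
  | nil => exact h.elim
  | cons x l ih =>
    rcases h with h | h
    · exact ⟨x, by simp, h.symm⟩
    · obtain ⟨y, hy, h⟩ := ih h
      exact ⟨y, by simp [hy], h⟩

theorem mem_states_targetFormula {S : Type} {code : S → ℕ} {o : Option (List (S × Bool))} {q : ℕ}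
    (h : q ∈ (targetFormula code o).states) : ∃ l, o = some l ∧ ∃ x ∈ l, code x.1 = q := by
  cases o with
  | none => exact h.elim
  | some l =>
    obtain ⟨y, hy, rfl⟩ := mem_states_conjFormula h
    obtain ⟨x, hx, rfl⟩ := List.mem_map.1 hy
    exact ⟨l, rfl, x, hx, rfl⟩

theorem noDisj_conjFormula : ∀ l, (conjFormula l).NoDisj
  | [] => trivial
  | _ :: l => ⟨trivial, noDisj_conjFormula l⟩

theorem noDisj_targetFormula {S : Type} (code : S → ℕ) (o : Option (List (S × Bool))) :
    (targetFormula code o).NoDisj := by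
  cases o with
  | none => trivial
  | some l => exact noDisj_conjFormula _

theorem guardOf_injective : Function.Injective guardOf := by
  intro b c h
  cases b <;> cases c <;> simp_all [guardOf]

/-- The automata whose emptiness problem is shown to be undecidable. -/
def Restricted (A : Automaton) : Prop :=
  A.WellFormed ∧ A.Universal ∧ A.HasIndex 1 2 ∧ A.NoEqualityTests ∧ A.OnlyTestsAboveOne

section Table

variable {S L : Type} {A : Automaton} {U : UnivSpec S L} {code : S → ℕ} {lcode : L → ℕ}
  {V : S → Prop}

/-- The entry of the transition table for a state, a letter, and a constraint. -/
def UnivSpec.rule (U : UnivSpec S L) (code : S → ℕ) (lcode : L → ℕ) (s : S) (a : L) (b : Bool) :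
    Rule :=
  ⟨code s, lcode a, guardOf b, targetFormula code (U.delta s a b)⟩

theorem implements_of_mem_rules (hcode : Function.Injective code)
    (hlcode : Function.Injective lcode) (hstart : A.start = code U.start) (hV : V U.start)
    (hVd : ∀ s a b l, V s → U.delta s a b = some l → ∀ x ∈ l, V x.1)
    (hrules : ∀ r, r ∈ A.rules ↔ ∃ s a b, V s ∧ r = U.rule code lcode s a b)
    (hwait : A.rank (code U.wait) = 1)
    (hother : ∀ s, V s → s ≠ U.wait → A.rank (code s) = 2) :
    Implements A U code lcode V where
  start := hstart
  code_inj := hcode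
  start_mem := hV
  delta_mem := hVd
  mem_rules s a b hs := (hrules _).2 ⟨s, a, b, hs, rfl⟩
  of_mem_rules r hr s a _ h₁ h₂ := by
    obtain ⟨s', a', b, _, rfl⟩ := (hrules r).1 hr
    have e₁ : s' = s := hcode h₁
    have e₂ : a' = a := hlcode h₂
    subst e₁ e₂
    exact ⟨b, rfl, rfl⟩
  rank_wait := hwait
  rank_other := hother

theorem restricted_of_mem_rules (hcode : Function.Injective code)
    (hlcode : Function.Injective lcode) (hstart : A.start = code U.start) (hV : V U.start)
    (hVd : ∀ s a b l, V s → U.delta s a b = some l → ∀ x ∈ l, V x.1)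
    (hrules : ∀ r, r ∈ A.rules ↔ ∃ s a b, V s ∧ r = U.rule code lcode s a b)
    (hlt : ∀ q, q < A.ranks.length ↔ ∃ s, V s ∧ code s = q) (hVw : V U.wait)
    (hne : U.start ≠ U.wait) (hllt : ∀ a, lcode a < A.numLetters)
    (hwait : A.rank (code U.wait) = 1)
    (hother : ∀ s, V s → s ≠ U.wait → A.rank (code s) = 2) : Restricted A := by
  refine ⟨⟨?_, ?_, ?_, ?_, ?_, ?_⟩, ?_, ⟨⟨?_, ?_⟩, ⟨?_, ?_⟩⟩, ?_, ?_⟩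
  · rw [hstart]
    exact (hlt _).2 ⟨_, hV, rfl⟩
  · intro r hr
    obtain ⟨s, a, b, hs, rfl⟩ := (hrules r).1 hr
    exact (hlt _).2 ⟨s, hs, rfl⟩
  · intro r hr
    obtain ⟨s, a, b, hs, rfl⟩ := (hrules r).1 hr
    exact hllt a
  · intro r hr q hq
    obtain ⟨s, a, b, hs, rfl⟩ := (hrules r).1 hr
    obtain ⟨l, hl, x, hx, rfl⟩ := mem_states_targetFormula hq
    exact (hlt _).2 ⟨x.1, hVd s a b l hs hl x hx, rfl⟩
  · intro r hr r' hr' h₁ h₂ h₃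
    obtain ⟨s, a, b, hs, rfl⟩ := (hrules r).1 hr
    obtain ⟨s', a', b', hs', rfl⟩ := (hrules r').1 hr'
    rw [hcode h₁, hlcode h₂, guardOf_injective h₃]
  · intro r hr r' hr' h₁ h₂ v _ h₃ h₄
    obtain ⟨s, a, b, hs, rfl⟩ := (hrules r).1 hr
    obtain ⟨s', a', b', hs', rfl⟩ := (hrules r').1 hr'
    change guardOf b = guardOf b'
    rw [(guardOf_sat b v).1 h₃, (guardOf_sat b' v).1 h₄]
  · intro r hr
    obtain ⟨s, a, b, hs, rfl⟩ := (hrules r).1 hr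
    exact noDisj_targetFormula _ _
  · exact ⟨_, (hlt _).2 ⟨_, hVw, rfl⟩, hwait⟩
  · rintro n ⟨q, hq, rfl⟩
    obtain ⟨s, hs, rfl⟩ := (hlt q).1 hq
    by_cases h : s = U.wait
    · rw [h, hwait]
    · rw [hother s hs h]
      norm_num
  · exact ⟨_, (hlt _).2 ⟨_, hV, rfl⟩, hother _ hV hne⟩
  · rintro n ⟨q, hq, rfl⟩
    obtain ⟨s, hs, rfl⟩ := (hlt q).1 hq
    by_cases h : s = U.wait
    · rw [h, hwait]
      norm_num
    · rw [hother s hs h]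
  · intro r hr
    obtain ⟨s, a, b, hs, rfl⟩ := (hrules r).1 hr
    refine ⟨?_, fun c hc => ?_⟩
    · intro x hx
      cases b <;> simp [UnivSpec.rule, guardOf] at hx <;> simp [hx]
    · have hmem : ∀ v : ℝ, 0 ≤ v → b = decide (1 < v) → v = c := by
        intro v hv hb
        have : v ∈ {v : ℝ | 0 ≤ v ∧ (U.rule code lcode s a b).guard.Sat v} :=
          ⟨hv, (guardOf_sat b v).2 hb⟩
        rwa [hc] at this
      cases b with
      | false =>
        have h₀ := hmem 0 le_rfl (by simp)
        have h₁ := hmem 1 (by norm_num) (by simp)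
        linarith
      | true =>
        have h₀ := hmem 2 (by norm_num) (by simp)
        have h₁ := hmem 3 (by norm_num) (by simp)
        linarith
  · intro r hr
    obtain ⟨s, a, b, hs, rfl⟩ := (hrules r).1 hr
    cases b
    · exact Or.inr rfl
    · exact Or.inl rfl

end Table

namespace StreamSpec

variable {L Γ : Type}

instance [Fintype L] : Fintype (FixedState L) :=
  Fintype.ofEquiv (Option L ⊕ (L × Option L) ⊕ Unit)
    { toFun := fun
        | .inl p => .main p
        | .inr (.inl x) => .copy x.1 x.2
        | .inr (.inr _) => .wait
      invFun := fun
        | .main p => .inl p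
        | .copy a p => .inr (.inl (a, p))
        | .wait => .inr (.inr ())
      left_inv := by rintro (_ | _ | _) <;> rfl
      right_inv := by rintro (_ | _ | _) <;> rfl }

/-- The states of the automaton for the input `m`. -/
def IsState (m : ℕ) : StreamState L → Prop
  | .inl _ => True
  | .inr k => k < m + 2

theorem isState_of_delta {X : StreamSpec L Γ} {m : ℕ} {e : ℕ → Γ} {s : StreamState L}
    {a : L} {b : Bool} {l : List (StreamState L × Bool)} (hs : IsState m s)
    (hl : (X.univSpec e m).delta s a b = some l) {x : StreamState L × Bool} (hx : x ∈ l) :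
    IsState m x.1 := by
  rcases s with (p | ⟨c, p⟩ | _) | k
  · simp only [univSpec, fixedDelta] at hl
    split_ifs at hl with h₁ h₂
    · cases hl
      simp only [List.mem_cons, List.not_mem_nil, or_false] at hx
      rcases hx with rfl | rfl | rfl | rfl
      · trivial
      · trivial
      · trivial
      · exact Nat.succ_pos _
    · cases hl
      simp only [List.mem_cons, List.not_mem_nil, or_false] at hx
      rcases hx with rfl | rfl | rfl <;> trivial
  · cases b <;> simp only [univSpec, fixedDelta] at hl <;> split_ifs at hl <;> cases hl
    · rw [List.mem_singleton] at hx
      subst hx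
      trivial
    · simp at hx
  · simp only [univSpec, fixedDelta] at hl
    split_ifs at hl <;> cases hl
    · simp at hx
    · rw [List.mem_singleton] at hx
      subst hx
      trivial
  · simp only [univSpec, checkDelta] at hl
    split at hl
    · cases hl
      simp at hx
    · split_ifs at hl <;> cases hl <;> rw [List.mem_singleton] at hx <;> subst hx
      · change k + 1 < m + 2
        omega
      · exact hs

variable [Fintype L]

/-- The number of the states that do not depend on the input. -/
def numFixed (L : Type) [Fintype L] : ℕ := Fintype.card (FixedState L)

/-- The numbering of the states. -/
noncomputable def code : StreamState L → ℕ
  | .inl s => Fintype.equivFin (FixedState L) s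
  | .inr k => numFixed L + k

/-- The numbering of the letters. -/
noncomputable def letterCode (a : L) : ℕ := Fintype.equivFin L a

theorem code_injective : Function.Injective (code (L := L)) := by
  rintro (s | k) (s' | k') h
  · simp only [code] at h
    rw [(Fintype.equivFin _).injective (Fin.ext h)]
  · have := (Fintype.equivFin (FixedState L) s).2
    simp only [code, numFixed] at h
    omega
  · have := (Fintype.equivFin (FixedState L) s').2
    simp only [code, numFixed] at h
    omega
  · simp only [code] at h
    rw [Nat.add_left_cancel h]

theorem letterCode_injective : Function.Injective (letterCode (L := L)) :=
  fun _ _ h => (Fintype.equivFin L).injective (Fin.ext h)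

variable (X : StreamSpec L Γ) (blank b₀ b₁ : Γ)

/-- The transitions from the states that do not depend on the input. -/
noncomputable def fixedRules : List Rule :=
  (Finset.univ : Finset (FixedState L × L × Bool)).toList.map fun x =>
    ⟨code (.inl x.1), letterCode x.2.1, guardOf x.2.2,
      targetFormula code (X.fixedDelta x.1 x.2.1 x.2.2)⟩

/-- The transitions from the state that expects the value number `k` of the input `m`. -/
noncomputable def checkRules (m k : ℕ) : List Rule :=
  (Finset.univ : Finset (L × Bool)).toList.map fun x =>
    ⟨code (.inr k : StreamState L), letterCode x.1, guardOf x.2,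
      targetFormula code (X.checkDelta (inputTape blank b₀ b₁ m) m k x.1)⟩

/-- The automaton that tests the conditions `X` for the input `m`. -/
noncomputable def automaton (m : ℕ) : Automaton where
  ranks := (List.range (numFixed L + (m + 2))).map fun q =>
    if q = code (.inl .wait : StreamState L) then 1 else 2
  numLetters := Fintype.card L
  start := code (.inl (.main none) : StreamState L)
  rules := X.fixedRules ++ (List.range (m + 2)).flatMap fun k => X.checkRules blank b₀ b₁ m k

variable {X} {blank b₀ b₁} {m : ℕ}

theorem mem_rules (r : Rule) : r ∈ (X.automaton blank b₀ b₁ m).rules ↔ ∃ s a b, IsState m s ∧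
    r = (X.univSpec (inputTape blank b₀ b₁ m) m).rule code letterCode s a b := by
  simp only [automaton, fixedRules, checkRules, List.mem_append, List.mem_map, List.mem_flatMap,
    Finset.mem_toList, Finset.mem_univ, true_and, List.mem_range]
  constructor
  · rintro (⟨⟨s, a, b⟩, rfl⟩ | ⟨k, hk, ⟨a, b⟩, rfl⟩)
    · exact ⟨.inl s, a, b, trivial, rfl⟩
    · exact ⟨.inr k, a, b, hk, rfl⟩
  · rintro ⟨s | k, a, b, hs, rfl⟩
    · exact Or.inl ⟨(s, a, b), rfl⟩
    · exact Or.inr ⟨k, hs, (a, b), rfl⟩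

theorem lt_length_ranks (q : ℕ) : q < (X.automaton blank b₀ b₁ m).ranks.length ↔
    ∃ s : StreamState L, IsState m s ∧ code s = q := by
  simp only [automaton, List.length_map, List.length_range]
  constructor
  · intro h
    by_cases hq : q < numFixed L
    · exact ⟨.inl ((Fintype.equivFin (FixedState L)).symm ⟨q, hq⟩), trivial, by simp [code]⟩
    · exact ⟨.inr (q - numFixed L), by change _ < _; omega, by simp only [code]; omega⟩
  · rintro ⟨s | k, hs, rfl⟩
    · have := (Fintype.equivFin (FixedState L) s).2
      simp only [code, numFixed]
      omega
    · simp only [code]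
      change k < m + 2 at hs
      omega

open scoped Classical in
theorem rank_code {s : StreamState L} (hs : IsState m s) :
    (X.automaton blank b₀ b₁ m).rank (code s) = if s = .inl .wait then 1 else 2 := by
  have h : code s < numFixed L + (m + 2) := by
    have := (lt_length_ranks (X := X) (blank := blank) (b₀ := b₀) (b₁ := b₁) (code s)).2
      ⟨s, hs, rfl⟩
    simpa [automaton] using this
  simp only [Automaton.rank, automaton]
  rw [List.getD_eq_getElem _ _ (by simpa using h), List.getElem_map, List.getElem_range]
  simp only [code_injective.eq_iff]

theorem rank_wait : (X.automaton blank b₀ b₁ m).rank (code (.inl .wait : StreamState L)) = 1 := by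
  rw [rank_code (by trivial), if_pos rfl]

theorem rank_other (s : StreamState L) (hs : IsState m s) (h : s ≠ .inl .wait) :
    (X.automaton blank b₀ b₁ m).rank (code s) = 2 := by
  rw [rank_code hs, if_neg h]

theorem automaton_restricted : Restricted (X.automaton blank b₀ b₁ m) :=
  restricted_of_mem_rules (U := X.univSpec (inputTape blank b₀ b₁ m) m) (V := IsState m)
    code_injective letterCode_injective rfl trivial
    (fun _ _ _ _ hs hl _ hx => isState_of_delta hs hl hx) mem_rules lt_length_ranks trivial
    (by simp [univSpec]) (fun a => (Fintype.equivFin L a).2)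
    rank_wait rank_other

theorem implements_automaton : Implements (X.automaton blank b₀ b₁ m)
    (X.univSpec (inputTape blank b₀ b₁ m) m) code letterCode (IsState m) :=
  implements_of_mem_rules code_injective letterCode_injective rfl trivial
    (fun _ _ _ _ hs hl _ hx => isState_of_delta hs hl hx) mem_rules rank_wait rank_other

theorem inputTape_eq_blank (n : ℕ) (hn : n > m) :
    inputTape blank b₀ b₁ m n = inputTape blank b₀ b₁ m (m + 1) := by
  rw [inputTape, inputTape, if_neg (by omega), if_neg (by omega), if_neg (by omega),
    if_neg (by omega)]

theorem delay_eq_delayOf {n : ℕ} (w : TimedWord n) : w.delay = delayOf w.time := by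
  funext k
  cases k <;> rfl

/-- The automaton for the conditions `X` accepts a non-Zeno word if and only if some non-Zeno word
meets these conditions. -/
theorem acceptsNonZeno_iff : (X.automaton blank b₀ b₁ m).AcceptsNonZeno ↔
    ∃ (ℓ : ℕ → L) (t : ℕ → ℝ), StrictMono t ∧ (∀ i, 0 ≤ t i) ∧ (∀ M, ∃ i, M < t i) ∧
      X.Stream (inputTape blank b₀ b₁ m) ℓ t := by
  constructor
  · rintro ⟨w, hw, σ, hσ⟩
    let ℓ : ℕ → L := fun i => (Fintype.equivFin L).symm ⟨w.letter i, w.letter_lt i⟩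
    have hℓ : ∀ i, w.letter i = letterCode (ℓ i) := fun i => by simp [ℓ, letterCode]
    refine ⟨ℓ, w.time, w.time_strictMono, w.time_nonneg, hw, ?_⟩
    refine stream_of_reach (m := m) ?_ w.time_strictMono.monotone inputTape_eq_blank ?_
    · intro k s v hs
      rw [← delay_eq_delayOf] at hs ⊢
      exact hσ.delta_ne_none implements_automaton hℓ hs
    · intro k v hs
      rw [← delay_eq_delayOf] at hs
      exact hσ.exists_acc implements_automaton hℓ hs
  · rintro ⟨ℓ, t, ht, ht₀, hM, h⟩
    refine ⟨⟨fun i => letterCode (ℓ i), fun i => (Fintype.equivFin L (ℓ i)).2, t, ht₀, ht⟩, hM, ?_⟩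
    refine accepts_of_reach implements_automaton (fun i => rfl) ?_ (fun k v _ => h.acc k)
    intro k s v hs
    rw [delay_eq_delayOf] at hs ⊢
    obtain ⟨l, hl, -⟩ := h.delta_eq_some inputTape_eq_blank (h.reachable inputTape_eq_blank hs)
    rw [hl]
    simp

end StreamSpec

/-! ### Computability of the construction -/

namespace StreamSpec

variable {L Γ : Type} [Fintype L] {X : StreamSpec L Γ} {blank b₀ b₁ : Γ}

theorem primrec_ruleMk {α : Type} [Primcodable α] {s a : α → ℕ} {g : Guard} {b : α → Formula}
    (hs : Primrec s) (ha : Primrec a) (hb : Primrec b) :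
    Primrec fun x => (⟨s x, a x, g, b x⟩ : Rule) := by
  have h : Primrec Rule.equivProd.symm := Primrec.of_equiv_symm
  exact (h.comp (hs.pair (ha.pair ((Primrec.const g).pair hb)))).of_eq fun _ => rfl

theorem primrec_atom {α : Type} [Primcodable α] {q : α → ℕ} (hq : Primrec q) :
    Primrec fun x => Formula.atom (q x) false := by
  have h : Primrec Formula.equivNat.symm := Primrec.of_equiv_symm
  refine (h.comp (Primrec.nat_add.comp (Primrec.nat_mul.comp (Primrec.const 4) hq)
    (Primrec.const 2))).of_eq fun x => ?_
  exact Formula.equivNat.symm_apply_apply (.atom (q x) false)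

theorem primrec_and_top {α : Type} [Primcodable α] {b : α → Formula} (hb : Primrec b) :
    Primrec fun x => Formula.and (b x) .top := by
  have h : Primrec Formula.equivNat.symm := Primrec.of_equiv_symm
  have h' : Primrec Formula.equivNat := Primrec.of_equiv
  refine (h.comp (Primrec.nat_add.comp (Primrec.nat_mul.comp (Primrec.const 4)
    (Primrec₂.natPair.comp (h'.comp hb) (Primrec.const 0))) (Primrec.const 4))).of_eq fun x => ?_
  exact Formula.equivNat.symm_apply_apply (.and (b x) .top)

theorem primrecPred_inputTape (g : Γ) :
    PrimrecPred fun x : ℕ × ℕ => g = inputTape blank b₀ b₁ x.1 x.2 := by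
  classical
  have h₀ : PrimrecPred fun x : ℕ × ℕ => x.2 = 0 :=
    Primrec.eq.comp Primrec.snd (Primrec.const 0)
  have h₁ : PrimrecPred fun x : ℕ × ℕ => x.2 ≤ x.1 := Primrec.nat_le.comp Primrec.snd Primrec.fst
  have h : Primrec fun x : ℕ × ℕ => if x.2 = 0 then decide (g = b₁) else
      if x.2 ≤ x.1 then decide (g = b₀) else decide (g = blank) :=
    Primrec.ite h₀ (Primrec.const _) (Primrec.ite h₁ (Primrec.const _) (Primrec.const _))
  refine PrimrecPred.of_eq (p := fun x : ℕ × ℕ => (if x.2 = 0 then decide (g = b₁) else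
      if x.2 ≤ x.1 then decide (g = b₀) else decide (g = blank)) = true)
      (Primrec.primrecPred (h.of_eq fun x => Bool.decide_eq_true.symm)) fun x => ?_
  simp only [inputTape]
  split_ifs <;> simp

theorem primrec_checkTarget (a : L) : Primrec fun x : ℕ × ℕ =>
    targetFormula code (X.checkDelta (inputTape blank b₀ b₁ x.1) x.1 x.2 a) := by
  classical
  unfold checkDelta
  cases X.val a with
  | none => exact Primrec.const _
  | some g =>
    have h₁ : PrimrecPred fun x : ℕ × ℕ => x.2 ≤ x.1 := Primrec.nat_le.comp Primrec.snd Primrec.fst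
    have hk : Primrec fun x : ℕ × ℕ => numFixed L + if x.2 ≤ x.1 then x.2 + 1 else x.2 :=
      Primrec.nat_add.comp (Primrec.const _)
        (Primrec.ite h₁ (Primrec.succ.comp Primrec.snd) Primrec.snd)
    refine (Primrec.ite (primrecPred_inputTape (blank := blank) (b₀ := b₀) (b₁ := b₁) g)
      (primrec_and_top (primrec_atom hk)) (Primrec.const Formula.bot)).of_eq fun x => ?_
    simp only
    split_ifs <;> rfl

theorem primrec_checkRules : Primrec₂ fun m k => X.checkRules blank b₀ b₁ m k := by
  unfold checkRules
  induction (Finset.univ : Finset (L × Bool)).toList with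
  | nil => exact Primrec.const _
  | cons y l ih =>
    refine Primrec.list_cons.comp (primrec_ruleMk ?_ (Primrec.const _) (primrec_checkTarget y.1)) ih
    exact Primrec.nat_add.comp (Primrec.const _) Primrec.snd

theorem computable_automaton : Computable fun m => X.automaton blank b₀ b₁ m := by
  have h : Primrec Automaton.equivProd.symm := Primrec.of_equiv_symm
  have hm : Primrec fun m : ℕ => m + 2 := Primrec.nat_add.comp Primrec.id (Primrec.const 2)
  have h₁ : Primrec fun m : ℕ => (List.range (numFixed L + (m + 2))).map fun q =>
      if q = code (.inl .wait : StreamState L) then 1 else 2 :=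
    Primrec.list_map (Primrec.list_range.comp (Primrec.nat_add.comp (Primrec.const _) hm))
      (Primrec.ite (Primrec.eq.comp Primrec.snd (Primrec.const _)) (Primrec.const 1)
        (Primrec.const 2))
  have h₂ : Primrec fun m : ℕ => X.fixedRules ++
      (List.range (m + 2)).flatMap fun k => X.checkRules blank b₀ b₁ m k :=
    Primrec.list_append.comp (Primrec.const _)
      (Primrec.list_flatMap (Primrec.list_range.comp hm) primrec_checkRules)
  exact (h.comp (h₁.pair ((Primrec.const _).pair ((Primrec.const _).pair h₂)))).to_comp

end StreamSpec

/-! ### Letters and conditions that encode computations -/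

/-- How a row is turned into the next one: by a step of the machine (which moves the head right or
left, or writes), or by the end of a round, or by the end of a phase. -/
inductive Op
  | right | left | stay | finish | restart
  deriving DecidableEq

instance : Fintype Op :=
  ⟨{.right, .left, .stay, .finish, .restart}, fun x => by cases x <;> simp⟩

/-- The operation is a step of the machine. -/
def Op.IsStep : Op → Prop
  | .right | .left | .stay => True
  | .finish | .restart => False

/-- The content of a cell: the parity of its position, whether it is active, whether it is ticked,
and the symbols at its distance to the left and to the right of the head. -/
structure Content (Γ : Type) where
  par : Bool
  act : Bool
  tick : Bool
  l : Γ
  r : Γ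

/-- The letter in front of a row: the state of the machine and the scanned symbol, now and in
the next row, and the operation on this row. -/
structure Header (Q Γ : Type) where
  op : Op
  q : Q
  g : Γ
  nq : Q
  ng : Γ

/-- The letter for a cell: the operation on the row, the content, and the content of the image of
the cell in the next row. -/
structure Cell (Γ : Type) where
  op : Op
  cur : Content Γ
  nxt : Content Γ

/-- The letters of the words that encode computations. -/
inductive Letter (Q Γ : Type)
  | header (h : Header Q Γ)
  | cell (c : Cell Γ)

noncomputable instance {Γ : Type} [Fintype Γ] : Fintype (Content Γ) :=
  Fintype.ofInjective (fun c => (c.par, c.act, c.tick, c.l, c.r)) (by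
    rintro ⟨⟩ ⟨⟩ h
    simpa using h)

noncomputable instance {Q Γ : Type} [Fintype Q] [Fintype Γ] : Fintype (Header Q Γ) :=
  Fintype.ofInjective (fun h => (h.op, h.q, h.g, h.nq, h.ng)) (by
    rintro ⟨⟩ ⟨⟩ h
    simpa using h)

noncomputable instance {Γ : Type} [Fintype Γ] : Fintype (Cell Γ) :=
  Fintype.ofInjective (fun c => (c.op, c.cur, c.nxt)) (by
    rintro ⟨⟩ ⟨⟩ h
    simpa using h)

noncomputable instance {Q Γ : Type} [Fintype Q] [Fintype Γ] : Fintype (Letter Q Γ) :=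
  Fintype.ofInjective
    (fun | .header h => (Sum.inl h : Header Q Γ ⊕ Cell Γ) | .cell c => Sum.inr c) (by
    rintro (_ | _) (_ | _) h <;> simp_all)

namespace Machine

variable (T : Machine)

/-- The header announces the right successor. -/
def HeaderOk (h : Header T.Q T.Γ) : Prop :=
  match h.op with
  | .right => T.M h.q h.g = some (h.nq, .move .right)
  | .left => T.M h.q h.g = some (h.nq, .move .left)
  | .stay => T.M h.q h.g = some (h.nq, .write h.ng)
  | .finish | .restart => h.nq = T.start ∧ h.ng = T.mark

/-- What the content of a cell says about the content of its image. When a round is finished, all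
active cells are ticked; when a phase is finished, no cell is active, and all become so. -/
def CellOk (c : Cell T.Γ) : Prop :=
  c.nxt.par = c.cur.par ∧
  match c.op with
  | .right | .left => c.cur.act → c.nxt.act
  | .stay => (c.cur.act → c.nxt.act) ∧ c.nxt.l = c.cur.l ∧ c.nxt.r = c.cur.r
  | .finish => (c.cur.act → c.cur.tick) ∧ ¬ c.nxt.tick ∧ c.nxt.l = T.blank
  | .restart => ¬ c.cur.act ∧ c.nxt.act ∧ ¬ c.nxt.tick ∧ c.nxt.l = T.blank

/-- The compatibility of a header and the first cell. Each step of the machine ticks one cell. -/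
def FirstOk (h : Header T.Q T.Γ) (c : Cell T.Γ) : Prop :=
  c.op = h.op ∧
  match h.op with
  | .right => c.nxt.tick ∧ c.nxt.l = h.g ∧ h.ng = c.cur.r
  | .left => c.nxt.tick ∧ c.nxt.r = h.g ∧ h.ng = c.cur.l
  | .stay => c.nxt.tick
  | .finish | .restart => True

/-- The compatibility of adjacent cells. The active cells form a prefix of the row, and all of them
but the last stay active at the end of a round. -/
def PairOk (c d : Cell T.Γ) : Prop :=
  d.op = c.op ∧ d.cur.par ≠ c.cur.par ∧ (d.cur.act → c.cur.act) ∧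
  match c.op with
  | .right => d.nxt.tick = c.cur.tick ∧ d.nxt.l = c.cur.l ∧ c.nxt.r = d.cur.r
  | .left => d.nxt.tick = c.cur.tick ∧ c.nxt.l = d.cur.l ∧ d.nxt.r = c.cur.r
  | .stay => d.nxt.tick = c.cur.tick
  | .finish => d.cur.act → c.nxt.act
  | .restart => True

/-- The conditions on the words that encode computations. -/
def spec : StreamSpec (Letter T.Q T.Γ) T.Γ where
  first
    | .header h => h.op = .restart ∧ T.HeaderOk h
    | .cell _ => False
  adj
    | .header h, .cell c => T.FirstOk h c ∧ T.CellOk c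
    | .cell c, .cell d => T.PairOk c d ∧ T.CellOk d
    | .cell _, .header h => T.HeaderOk h
    | .header _, .header _ => False
  mtch
    | .header h, .header h', _ => h'.q = h.nq ∧ h'.g = h.ng
    | .cell c, .cell d, .cell _ => d.cur = c.nxt
    | .cell c, .cell d, .header _ => d.cur = c.nxt ∧ c.op ≠ .restart
    | _, _, _ => False
  hdr
    | .header _ => True
    | .cell _ => False
  acc
    | .header h => h.op = .restart
    | .cell _ => False
  chk
    | .header h => ¬ h.op.IsStep
    | .cell _ => False
  val
    | .header _ => none
    | .cell c => some c.nxt.r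

/-- A sequence of rows as the conditions `Machine.spec` describe it. The row number `k` consists of
the header `hd k` and the cells `cell k p` for `p < len k`; the image of the cell number `p`
is the cell number `img k p` of the next row. Cells of the next row that are not images are
insertions. -/
structure Rows (e : ℕ → T.Γ) (hd : ℕ → Header T.Q T.Γ) (len : ℕ → ℕ) (cell : ℕ → ℕ → Cell T.Γ)
    (img : ℕ → ℕ → ℕ) : Prop where
  header_ok : ∀ k, T.HeaderOk (hd k)
  len_pos : ∀ k, 0 < len k
  first_ok : ∀ k, T.FirstOk (hd k) (cell k 0)
  cell_ok : ∀ k p, p < len k → T.CellOk (cell k p)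
  pair_ok : ∀ k p, p + 1 < len k → T.PairOk (cell k p) (cell k (p + 1))
  hd_next : ∀ k, (hd (k + 1)).q = (hd k).nq ∧ (hd (k + 1)).g = (hd k).ng
  img_lt : ∀ k p, p < len k → img k p < len (k + 1)
  img_strictMono : ∀ k p p', p < p' → p' < len k → img k p < img k p'
  cur_img : ∀ k p, p < len k → (cell (k + 1) (img k p)).cur = (cell k p).nxt
  grow : ∀ k p, (hd k).op = .restart → p < len k → img k p + 1 < len (k + 1)
  input : ∀ k p, ¬ (hd k).op.IsStep → p < len k → (cell k p).nxt.r = e p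
  acc : ∀ k, ∃ j ≥ k, (hd j).op = .restart
  start : (hd 0).op = .restart

end Machine

/-! ### Timed words that meet the conditions consist of rows -/

namespace Machine

variable {T : Machine}

/-- The header in a letter; the default is irrelevant. -/
def toHeader (T : Machine) : Letter T.Q T.Γ → Header T.Q T.Γ
  | .header h => h
  | .cell _ => ⟨.restart, T.start, T.mark, T.start, T.mark⟩

/-- The cell in a letter; the default is irrelevant. -/
def toCell (T : Machine) : Letter T.Q T.Γ → Cell T.Γ
  | .header _ =>
    ⟨.restart, ⟨true, true, true, T.blank, T.blank⟩, ⟨true, true, true, T.blank, T.blank⟩⟩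
  | .cell c => c

theorem eq_header_of_hdr {a : Letter T.Q T.Γ} (h : T.spec.hdr a) : a = .header (T.toHeader a) := by
  cases a with
  | header => rfl
  | cell => exact h.elim

theorem eq_cell_of_not_hdr {a : Letter T.Q T.Γ} (h : ¬ T.spec.hdr a) : a = .cell (T.toCell a) := by
  cases a with
  | header => exact (h trivial).elim
  | cell => rfl

section

variable {e : ℕ → T.Γ} {ℓ : ℕ → Letter T.Q T.Γ} {t : ℕ → ℝ}

theorem cellOk_of_stream (h : T.spec.Stream e ℓ t) {i : ℕ} {c : Cell T.Γ} (hc : ℓ i = .cell c) :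
    T.CellOk c := by
  cases i with
  | zero =>
    have := h.first
    rw [hc] at this
    exact this.elim
  | succ i =>
    have := h.adj i
    rw [hc] at this
    cases hi : ℓ i <;> rw [hi] at this <;> exact this.2

theorem headerOk_of_stream (h : T.spec.Stream e ℓ t) {i : ℕ} {c : Header T.Q T.Γ}
    (hc : ℓ i = .header c) : T.HeaderOk c := by
  cases i with
  | zero =>
    have := h.first
    rw [hc] at this
    exact this.2
  | succ i =>
    have := h.adj i
    rw [hc] at this
    cases hi : ℓ i <;> rw [hi] at this
    · exact this.elim
    · exact this

theorem hdr_iff_of_mtch {a b c : Letter T.Q T.Γ} (h : T.spec.mtch a b c) :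
    T.spec.hdr a ↔ T.spec.hdr b := by
  cases a <;> cases b <;> cases c <;> first | exact Iff.rfl | exact h.elim

theorem cell_of_mtch {c d : Cell T.Γ} {b : Letter T.Q T.Γ} (h : T.spec.mtch (.cell c) (.cell d) b) :
    d.cur = c.nxt ∧ (c.op = .restart → ¬ T.spec.hdr b) := by
  cases b with
  | header => exact ⟨h.1, fun h' => (h.2 h').elim⟩
  | cell => exact ⟨h, fun _ => id⟩

/-- Each letter of a non-Zeno word has an image, and distinct letters have distinct images. -/
theorem exists_image (h : T.spec.Stream e ℓ t) (ht : StrictMono t) (hM : ∀ M, ∃ i, M < t i) :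
    ∃ φ : ℕ → ℕ, StrictMono φ ∧ ∀ i, i < φ i ∧ t (φ i) ≤ t i + 1 ∧
      T.spec.mtch (ℓ i) (ℓ (φ i)) (ℓ (φ i + 1)) := by
  have hex : ∀ i, ∃ j, i < j ∧ t j ≤ t i + 1 ∧ t i + 1 < t (j + 1) := by
    intro i
    let n := Nat.find (hM (t i + 1))
    have hn : t i + 1 < t n := Nat.find_spec (hM (t i + 1))
    have hin : i + 1 < n := by
      by_contra hlt
      have := ht.monotone (not_lt.1 hlt)
      linarith [h.next_le i]
    refine ⟨n - 1, by omega, not_lt.1 (Nat.find_min (hM (t i + 1)) (m := n - 1) (by omega)), ?_⟩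
    rwa [show n - 1 + 1 = n by omega]
  choose φ hφ₁ hφ₂ hφ₃ using hex
  have hm : ∀ i, T.spec.mtch (ℓ i) (ℓ (φ i)) (ℓ (φ i + 1)) :=
    fun i => h.image i (φ i) (hφ₁ i) (hφ₂ i) (hφ₃ i)
  refine ⟨φ, strictMono_nat_of_lt_succ fun i => ?_, fun i => ⟨hφ₁ i, hφ₂ i, hm i⟩⟩
  have hle : φ i ≤ φ (i + 1) := by
    have h₁ : t i < t (i + 1) := ht (Nat.lt_succ_self i)
    have h₂ : t (φ i) < t (φ (i + 1) + 1) := by linarith [hφ₂ i, hφ₃ (i + 1)]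
    exact Nat.lt_succ_iff.1 (ht.lt_iff_lt.1 h₂)
  refine lt_of_le_of_ne hle fun heq => ?_
  -- Adjacent letters differ in kind or parity, and these are passed on to the images.
  have m₁ := hm i
  have m₂ := hm (i + 1)
  rw [← heq] at m₂
  have hadj := h.adj i
  by_cases hh : T.spec.hdr (ℓ i)
  · have h' := (hdr_iff_of_mtch m₂).2 ((hdr_iff_of_mtch m₁).1 hh)
    rw [eq_header_of_hdr hh, eq_header_of_hdr h'] at hadj
    exact hadj
  · have h₁ := eq_cell_of_not_hdr hh
    have h₂ := eq_cell_of_not_hdr (mt (hdr_iff_of_mtch m₁).2 hh)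
    have h₃ := eq_cell_of_not_hdr (mt (fun h' => (hdr_iff_of_mtch m₁).2
      ((hdr_iff_of_mtch m₂).1 h')) hh)
    have ok₁ := cellOk_of_stream h h₁
    have ok₃ := cellOk_of_stream h h₃
    rw [h₁, h₂] at m₁
    rw [h₃, h₂] at m₂
    rw [h₁, h₃] at hadj
    have e₁ := (cell_of_mtch m₁).1
    have e₂ := (cell_of_mtch m₂).1
    apply hadj.1.2.1
    rw [← ok₃.1, ← e₂, e₁, ok₁.1]

/-- A non-Zeno word that meets the conditions consists of rows. -/
theorem exists_rows (h : T.spec.Stream e ℓ t) (ht : StrictMono t) (hM : ∀ M, ∃ i, M < t i) :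
    ∃ hd len cell img, T.Rows e hd len cell img := by
  obtain ⟨φ, hφ, hφ'⟩ := exists_image h ht hM
  -- The headers are the iterated images of the first letter.
  let H : ℕ → ℕ := fun k => φ^[k] 0
  have hH : ∀ k, H (k + 1) = φ (H k) := fun k => Function.iterate_succ_apply' φ k 0
  have hHlt : ∀ k, H k < H (k + 1) := fun k => by
    rw [hH]
    exact (hφ' _).1
  have hHmono : StrictMono H := strictMono_nat_of_lt_succ hHlt
  have hhdr : ∀ k, T.spec.hdr (ℓ (H k)) := by
    intro k
    induction k with
    | zero =>
      have := h.first
      change T.spec.hdr (ℓ 0)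
      cases h0 : ℓ 0 with
      | header => trivial
      | cell => rw [h0] at this; exact this.elim
    | succ k ih =>
      rw [hH]
      exact (hdr_iff_of_mtch (hφ' (H k)).2.2).1 ih
  have hcell : ∀ k j, H k < j → j < H (k + 1) → ¬ T.spec.hdr (ℓ j) := by
    intro k j h₁ h₂
    refine h.hdr (H k) j h₁ ?_ (hhdr k)
    rw [hH] at h₂
    exact (ht.monotone (Nat.succ_le_of_lt h₂)).trans (hφ' (H k)).2.1
  let len : ℕ → ℕ := fun k => H (k + 1) - H k - 1
  let hd : ℕ → Header T.Q T.Γ := fun k => T.toHeader (ℓ (H k))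
  let cell : ℕ → ℕ → Cell T.Γ := fun k p => T.toCell (ℓ (H k + 1 + p))
  let img : ℕ → ℕ → ℕ := fun k p => φ (H k + 1 + p) - H (k + 1) - 1
  have hd_eq : ∀ k, ℓ (H k) = .header (hd k) := fun k => eq_header_of_hdr (hhdr k)
  have cell_eq : ∀ k p, p < len k → ℓ (H k + 1 + p) = .cell (cell k p) := fun k p hp =>
    eq_cell_of_not_hdr (hcell k _ (by omega) (by have := hHlt k; simp only [len] at hp; omega))
  have img_eq : ∀ k p, p < len k → φ (H k + 1 + p) = H (k + 1) + 1 + img k p := by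
    intro k p hp
    have : H (k + 1) < φ (H k + 1 + p) := by
      rw [hH]
      exact hφ (by omega)
    simp only [img]
    omega
  have img_lt : ∀ k p, p < len k → img k p < len (k + 1) := by
    intro k p hp
    have h₁ : φ (H k + 1 + p) < H (k + 1 + 1) := by
      rw [hH (k + 1)]
      exact hφ (by simp only [len] at hp; omega)
    have h₂ := img_eq k p hp
    simp only [len]
    omega
  have len_pos : ∀ k, 0 < len k := by
    intro k
    by_contra h0
    have h₁ : H (k + 1) = H k + 1 := by
      have := hHlt k
      simp only [len] at h0
      omega
    have hadj := h.adj (H k)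
    rw [← h₁, hd_eq, hd_eq] at hadj
    exact hadj
  have hop : ∀ k p, p < len k → (cell k p).op = (hd k).op := by
    intro k p
    induction p with
    | zero =>
      intro hp
      have hadj := h.adj (H k)
      rw [hd_eq, show H k + 1 = H k + 1 + 0 from rfl, cell_eq k 0 hp] at hadj
      exact hadj.1.1
    | succ p ih =>
      intro hp
      have hadj := h.adj (H k + 1 + p)
      rw [cell_eq k p (by omega), add_assoc, cell_eq k (p + 1) hp] at hadj
      rw [hadj.1.1, ih (by omega)]
  refine ⟨hd, len, cell, img, ?_, len_pos, ?_, ?_, ?_, ?_, img_lt, ?_, ?_, ?_, ?_, ?_, ?_⟩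
  · exact fun k => headerOk_of_stream h (hd_eq k)
  · intro k
    have hadj := h.adj (H k)
    rw [hd_eq, show H k + 1 = H k + 1 + 0 from rfl, cell_eq k 0 (len_pos k)] at hadj
    exact hadj.1
  · exact fun k p hp => cellOk_of_stream h (cell_eq k p hp)
  · intro k p hp
    have hadj := h.adj (H k + 1 + p)
    rw [cell_eq k p (by omega), add_assoc, cell_eq k (p + 1) hp] at hadj
    exact hadj.1
  · intro k
    have hm := (hφ' (H k)).2.2
    rw [← hH, hd_eq, hd_eq] at hm
    exact hm
  · intro k p p' hp hp'
    have h₁ := img_eq k p (by omega)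
    have h₂ := img_eq k p' hp'
    have h₃ : φ (H k + 1 + p) < φ (H k + 1 + p') := hφ (by omega)
    omega
  · intro k p hp
    have hm := (hφ' (H k + 1 + p)).2.2
    rw [img_eq k p hp, cell_eq k p hp, cell_eq _ _ (img_lt k p hp)] at hm
    exact (cell_of_mtch hm).1
  · intro k p hr hp
    have hm := (hφ' (H k + 1 + p)).2.2
    rw [img_eq k p hp, cell_eq k p hp, cell_eq _ _ (img_lt k p hp)] at hm
    by_contra hno
    refine (cell_of_mtch hm).2 ((hop k p hp).trans hr) ?_
    have h₁ := img_lt k p hp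
    have h₂ : H (k + 1) + 1 + img k p + 1 = H (k + 1 + 1) := by
      have := hHlt (k + 1)
      simp only [len] at h₁ hno
      omega
    rw [h₂]
    exact hhdr _
  · intro k p hs hp
    have hchk : T.spec.chk (ℓ (H k)) := by
      rw [hd_eq]
      exact hs
    refine h.chk (H k) hchk p (fun r hr => ?_) _ ?_
    · rw [cell_eq k r (by omega)]
      exact Option.some_ne_none _
    · rw [cell_eq k p hp]
      rfl
  · intro k
    obtain ⟨j, hj, ha⟩ := h.acc (H k)
    have hjh : T.spec.hdr (ℓ j) := by
      cases hl : ℓ j with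
      | header => trivial
      | cell => rw [hl] at ha; exact ha.elim
    obtain ⟨k', hk'⟩ : ∃ k', H k' = j := by
      have hex : ∃ n, j < H n := ⟨j + 1, hHmono.le_apply⟩
      have h₁ := Nat.find_spec hex
      have h₀ : Nat.find hex ≠ 0 := by
        intro h0
        rw [h0] at h₁
        exact absurd h₁ (Nat.not_lt_zero j)
      have h₂ := Nat.find_min hex (m := Nat.find hex - 1) (by omega)
      refine ⟨Nat.find hex - 1, ?_⟩
      by_contra hne
      refine hcell (Nat.find hex - 1) j (by omega) ?_ hjh
      rwa [Nat.sub_add_cancel (Nat.one_le_iff_ne_zero.2 h₀)]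
    refine ⟨k', ?_, ?_⟩
    · rw [← hk'] at hj
      exact hHmono.le_iff_le.1 hj
    · rw [← hk', hd_eq] at ha
      exact ha
  · have := h.first
    rw [show (0 : ℕ) = H 0 from rfl, hd_eq] at this
    exact this.1

end

end Machine

/-! ### No rows for an input on which the machine halts -/

namespace Machine

/-- The configuration after `n` steps on input `m`; it stays the same after the machine halted. -/
def conf (T : Machine) (m n : ℕ) : TapeCfg T.Q T.Γ :=
  (fun C => (tapeStep T.M C).getD C)^[n] (T.init m)

variable {T : Machine} {m : ℕ}

theorem conf_succ (n : ℕ) :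
    T.conf m (n + 1) = (tapeStep T.M (T.conf m n)).getD (T.conf m n) :=
  Function.iterate_succ_apply' _ n _

theorem conf_succ_of_eq_some {n : ℕ} {q : T.Q} {s : TM0.Stmt T.Γ}
    (h : T.M (T.conf m n).q (T.conf m n).head = some (q, s)) :
    T.conf m (n + 1) = (T.conf m n).apply q s := by
  rw [conf_succ, tapeStep, h]
  rfl

theorem halts_iff : T.Halts m ↔ ∃ n, T.M (T.conf m n).q (T.conf m n).head = none := by
  have hnone : ∀ C : TapeCfg T.Q T.Γ, tapeStep T.M C = none ↔ T.M C.q C.head = none := by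
    intro C
    simp [tapeStep]
  constructor
  · intro h
    obtain ⟨h₁, h₂⟩ := StateTransition.mem_eval.1 (Part.get_mem h)
    have key : ∀ C, StateTransition.Reaches (tapeStep T.M) (T.init m) C →
        ∃ n, T.conf m n = C := by
      intro C hC
      induction hC with
      | refl => exact ⟨0, rfl⟩
      | tail _ hstep ih =>
        obtain ⟨n, rfl⟩ := ih
        refine ⟨n + 1, ?_⟩
        rw [conf_succ, Option.mem_def.1 hstep]
        rfl
    obtain ⟨n, hn⟩ := key _ h₁
    refine ⟨n, (hnone _).1 ?_⟩
    rw [hn]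
    exact h₂
  · rintro ⟨n, hn⟩
    have key : ∀ n, StateTransition.Reaches (tapeStep T.M) (T.init m) (T.conf m n) := by
      intro n
      induction n with
      | zero => exact Relation.ReflTransGen.refl
      | succ n ih =>
        rw [conf_succ]
        cases hs : tapeStep T.M (T.conf m n) with
        | none => exact ih
        | some C => exact ih.tail hs
    exact (StateTransition.mem_eval.2 ⟨key n, (hnone _).2 hn⟩).1

section

variable {hd : ℕ → Header T.Q T.Γ} {len : ℕ → ℕ} {cell : ℕ → ℕ → Cell T.Γ} {img : ℕ → ℕ → ℕ}

/-- The row number `k` has at least `b` active cells. -/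
def AtLeast (len : ℕ → ℕ) (cell : ℕ → ℕ → Cell T.Γ) (k b : ℕ) : Prop :=
  b ≤ len k ∧ ∀ p < b, (cell k p).cur.act

/-- The images of the first `b` cells of the row number `k` are active. -/
def Promises (len : ℕ → ℕ) (cell : ℕ → ℕ → Cell T.Γ) (k b : ℕ) : Prop :=
  b ≤ len k ∧ ∀ p < b, (cell k p).nxt.act

/-- The first cells of the row number `k` agree with the configuration after `s` steps, up to the
position `b - s`, and at most `s` of them are ticked. Since information travels one cell
per step, the part of the row beyond `b` cannot interfere. -/
def Simulates (m : ℕ) (hd : ℕ → Header T.Q T.Γ) (cell : ℕ → ℕ → Cell T.Γ) (b k s : ℕ) : Prop :=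
  (hd k).q = (T.conf m s).q ∧ (hd k).g = (T.conf m s).head ∧
    (∀ p, p + s < b → (cell k p).cur.l = (T.conf m s).left p ∧
      (cell k p).cur.r = (T.conf m s).right p) ∧
    ∀ p < b, (cell k p).cur.tick → p < s

namespace Rows

theorem op_cell (h : T.Rows (inputTape T.blank T.b₀ T.b₁ m) hd len cell img) {k p : ℕ}
    (hp : p < len k) : (cell k p).op = (hd k).op := by
  induction p with
  | zero => exact (h.first_ok k).1
  | succ p ih => rw [(h.pair_ok k p hp).1, ih (by omega)]

theorem le_img (h : T.Rows (inputTape T.blank T.b₀ T.b₁ m) hd len cell img) {k p : ℕ}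
    (hp : p < len k) : p ≤ img k p := by
  induction p with
  | zero => exact Nat.zero_le _
  | succ p ih => exact (ih (by omega)).trans_lt (h.img_strictMono k p (p + 1) (by omega) hp)

theorem atLeast_of_act (h : T.Rows (inputTape T.blank T.b₀ T.b₁ m) hd len cell img) {k p : ℕ}
    (hp : p < len k) (ha : (cell k p).cur.act) : AtLeast len cell k (p + 1) := by
  induction p with
  | zero =>
    refine ⟨hp, fun p hp => ?_⟩
    rwa [Nat.lt_one_iff.1 hp]
  | succ p ih =>
    refine ⟨hp, fun p' hp' => ?_⟩
    rcases Nat.lt_succ_iff_lt_or_eq.1 hp' with hp' | rfl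
    · exact (ih (by omega) ((h.pair_ok k p hp).2.2.1 ha)).2 p' hp'
    · exact ha

/-- Active images stay, and the first ones do not move unless an active cell is inserted. -/
theorem atLeast_succ (h : T.Rows (inputTape T.blank T.b₀ T.b₁ m) hd len cell img) {k b : ℕ}
    (hb : Promises len cell k b) : AtLeast len cell (k + 1) b ∧
      (AtLeast len cell (k + 1) (b + 1) ∨ ∀ p < b, (cell (k + 1) p).cur = (cell k p).nxt) := by
  obtain ⟨hlen, hact⟩ := hb
  rcases Nat.eq_zero_or_pos b with rfl | hpos
  · exact ⟨⟨Nat.zero_le _, fun p hp => absurd hp (Nat.not_lt_zero p)⟩,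
      Or.inr fun p hp => absurd hp (Nat.not_lt_zero p)⟩
  have hlast : b - 1 < len k := by omega
  have h₁ : AtLeast len cell (k + 1) (img k (b - 1) + 1) := by
    refine h.atLeast_of_act (h.img_lt k _ hlast) ?_
    rw [h.cur_img k _ hlast]
    exact hact _ (by omega)
  have h₂ := h.le_img hlast
  refine ⟨⟨by have := h₁.1; omega, fun p hp => h₁.2 p (by omega)⟩, ?_⟩
  by_cases hb' : b ≤ img k (b - 1)
  · exact Or.inl ⟨by have := h₁.1; omega, fun p hp => h₁.2 p (by omega)⟩
  · right
    have key : ∀ r p, p + r + 1 = b → img k p = p := by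
      intro r
      induction r with
      | zero =>
        intro p hp
        obtain rfl : p = b - 1 := by omega
        omega
      | succ r ih =>
        intro p hp
        have h₃ := h.img_strictMono k p (p + 1) (by omega) (by omega)
        have h₄ := ih (p + 1) (by omega)
        have h₅ := h.le_img (k := k) (p := p) (by omega)
        omega
    intro p hp
    have := h.cur_img k p (by omega)
    rwa [key (b - 1 - p) p (by omega)] at this

theorem promises_of_isStep (h : T.Rows (inputTape T.blank T.b₀ T.b₁ m) hd len cell img) {k b : ℕ}
    (hs : (hd k).op.IsStep) (hb : AtLeast len cell k b) : Promises len cell k b := by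
  refine ⟨hb.1, fun p hp => ?_⟩
  have hlt : p < len k := lt_of_lt_of_le hp hb.1
  have hc := h.cell_ok k p hlt
  have ha := hb.2 p hp
  unfold CellOk at hc
  rw [h.op_cell hlt] at hc
  cases hop : (hd k).op <;> rw [hop] at hc hs
  · exact hc.2 ha
  · exact hc.2 ha
  · exact hc.2.1 ha
  · exact hs.elim
  · exact hs.elim

theorem promises_of_finish (h : T.Rows (inputTape T.blank T.b₀ T.b₁ m) hd len cell img) {k b : ℕ}
    (hs : (hd k).op = .finish) (hb : AtLeast len cell k (b + 1)) : Promises len cell k b := by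
  have hlen := hb.1
  refine ⟨by omega, fun p hp => ?_⟩
  have hpair := (h.pair_ok k p (by omega)).2.2.2
  rw [h.op_cell (by omega), hs] at hpair
  exact hpair (hb.2 (p + 1) (by omega))

theorem promises_of_restart (h : T.Rows (inputTape T.blank T.b₀ T.b₁ m) hd len cell img) {k : ℕ}
    (hs : (hd k).op = .restart) : Promises len cell k (len k) := by
  refine ⟨le_rfl, fun p hp => ?_⟩
  have hc := (h.cell_ok k p hp).2
  rw [h.op_cell hp, hs] at hc
  exact hc.2.1

/-- After the end of a round or a phase, the machine is in its initial configuration. -/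
theorem simulates_zero (h : T.Rows (inputTape T.blank T.b₀ T.b₁ m) hd len cell img) {k b : ℕ}
    (hs : ¬ (hd k).op.IsStep) (hb : b ≤ len k)
    (heq : ∀ p < b, (cell (k + 1) p).cur = (cell k p).nxt) :
    Simulates m hd cell b (k + 1) 0 := by
  have hok := h.header_ok k
  have hstart : (hd k).nq = T.start ∧ (hd k).ng = T.mark := by
    unfold HeaderOk at hok
    cases hop : (hd k).op <;> rw [hop] at hok hs
    · exact (hs trivial).elim
    · exact (hs trivial).elim
    · exact (hs trivial).elim
    · exact hok
    · exact hok
  have hcell : ∀ p < b, ¬ (cell k p).nxt.tick ∧ (cell k p).nxt.l = T.blank := by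
    intro p hp
    have hc := (h.cell_ok k p (by omega)).2
    rw [h.op_cell (by omega)] at hc
    cases hop : (hd k).op <;> rw [hop] at hc hs
    · exact (hs trivial).elim
    · exact (hs trivial).elim
    · exact (hs trivial).elim
    · exact hc.2
    · exact hc.2.2
  refine ⟨(h.hd_next k).1.trans hstart.1, (h.hd_next k).2.trans hstart.2, fun p hp => ?_,
    fun p hp ht => ?_⟩
  · rw [heq p hp]
    exact ⟨(hcell p hp).2, h.input k p hs (by omega)⟩
  · rw [heq p hp] at ht
    exact absurd ht (hcell p hp).1

/-- A step without insertions of active cells is a step of the machine. -/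
theorem simulates_succ (h : T.Rows (inputTape T.blank T.b₀ T.b₁ m) hd len cell img) {k b s : ℕ}
    (hs : (hd k).op.IsStep) (hb : b ≤ len k) (hsb : s < b)
    (heq : ∀ p < b, (cell (k + 1) p).cur = (cell k p).nxt) (hsim : Simulates m hd cell b k s) :
    T.M (T.conf m s).q (T.conf m s).head ≠ none ∧ Simulates m hd cell b (k + 1) (s + 1) := by
  obtain ⟨hq, hg, hlr, htick⟩ := hsim
  have hok := h.header_ok k
  have hfirst := (h.first_ok k).2
  have hnext := h.hd_next k
  have hpair : ∀ p, p + 1 < b → _ := fun p hp => (h.pair_ok k p (by omega)).2.2.2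
  have hopc : ∀ p, p < b → (cell k p).op = (hd k).op := fun p hp => h.op_cell (by omega)
  have hcell : ∀ p, p < b → _ := fun p hp => (h.cell_ok k p (by omega)).2
  have hlr' := fun p (hp : p < b) => congrArg (fun c => (c.l, c.r, c.tick)) (heq p hp)
  simp only [Prod.mk.injEq] at hlr'
  unfold HeaderOk at hok
  rw [hq, hg] at hok
  have htick' : (∀ p, p + 1 < b → (cell k (p + 1)).nxt.tick = (cell k p).cur.tick) →
      ∀ p < b, (cell (k + 1) p).cur.tick → p < s + 1 := by
    intro hshift p hp ht
    cases p with
    | zero => omega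
    | succ p =>
      rw [(hlr' _ hp).2.2, hshift p hp] at ht
      have := htick p (by omega) ht
      omega
  cases hop : (hd k).op with
  | right =>
    simp only [hop] at hok hfirst
    refine ⟨by rw [hok]; simp, ?_⟩
    rw [Simulates, conf_succ_of_eq_some hok]
    have hp' : ∀ p, p + 1 < b → (cell k (p + 1)).nxt.tick = (cell k p).cur.tick ∧
        (cell k (p + 1)).nxt.l = (cell k p).cur.l ∧ (cell k p).nxt.r = (cell k (p + 1)).cur.r := by
      intro p hp
      have := hpair p hp
      rwa [hopc p (by omega), hop] at this
    refine ⟨hnext.1, ?_, fun p hp => ⟨?_, ?_⟩, htick' fun p hp => (hp' p hp).1⟩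
    · rw [hnext.2, hfirst.2.2, (hlr 0 (by omega)).2]
      rfl
    · rw [(hlr' p (by omega)).1]
      cases p with
      | zero =>
        rw [hfirst.2.1, hg]
        rfl
      | succ p =>
        rw [(hp' p (by omega)).2.1, (hlr p (by omega)).1]
        rfl
    · rw [(hlr' p (by omega)).2.1, (hp' p (by omega)).2.2, (hlr (p + 1) (by omega)).2]
      rfl
  | left =>
    simp only [hop] at hok hfirst
    refine ⟨by rw [hok]; simp, ?_⟩
    rw [Simulates, conf_succ_of_eq_some hok]
    have hp' : ∀ p, p + 1 < b → (cell k (p + 1)).nxt.tick = (cell k p).cur.tick ∧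
        (cell k p).nxt.l = (cell k (p + 1)).cur.l ∧ (cell k (p + 1)).nxt.r = (cell k p).cur.r := by
      intro p hp
      have := hpair p hp
      rwa [hopc p (by omega), hop] at this
    refine ⟨hnext.1, ?_, fun p hp => ⟨?_, ?_⟩, htick' fun p hp => (hp' p hp).1⟩
    · rw [hnext.2, hfirst.2.2, (hlr 0 (by omega)).1]
      rfl
    · rw [(hlr' p (by omega)).1, (hp' p (by omega)).2.1, (hlr (p + 1) (by omega)).1]
      rfl
    · rw [(hlr' p (by omega)).2.1]
      cases p with
      | zero =>
        rw [hfirst.2.1, hg]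
        rfl
      | succ p =>
        rw [(hp' p (by omega)).2.2, (hlr p (by omega)).2]
        rfl
  | stay =>
    simp only [hop] at hok
    refine ⟨by rw [hok]; simp, ?_⟩
    rw [Simulates, conf_succ_of_eq_some hok]
    have hp' : ∀ p, p + 1 < b → (cell k (p + 1)).nxt.tick = (cell k p).cur.tick := by
      intro p hp
      have := hpair p hp
      rwa [hopc p (by omega), hop] at this
    have hc' : ∀ p, p < b → (cell k p).nxt.l = (cell k p).cur.l ∧
        (cell k p).nxt.r = (cell k p).cur.r := by
      intro p hp
      have := hcell p hp
      rw [hopc p hp, hop] at this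
      exact this.2
    refine ⟨hnext.1, hnext.2, fun p hp => ⟨?_, ?_⟩, htick' hp'⟩
    · rw [(hlr' p (by omega)).1, (hc' p (by omega)).1, (hlr p (by omega)).1]
      rfl
    · rw [(hlr' p (by omega)).2.1, (hc' p (by omega)).2, (hlr p (by omega)).2]
      rfl
  | finish =>
    rw [hop] at hs
    exact hs.elim
  | restart =>
    rw [hop] at hs
    exact hs.elim

/-- A round that starts with `b` active cells keeps them, and it simulates the machine, as long as
no active cell is inserted. -/
theorem simulates_round (h : T.Rows (inputTape T.blank T.b₀ T.b₁ m) hd len cell img) {n k b : ℕ}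
    (hn : T.M (T.conf m n).q (T.conf m n).head = none) (hbn : n + 2 ≤ b)
    (hs : ¬ (hd k).op.IsStep) (hb : Promises len cell k b) (s : ℕ)
    (hsteps : ∀ i < s, (hd (k + 1 + i)).op.IsStep) :
    AtLeast len cell (k + 1 + s) b ∧
      (AtLeast len cell (k + 1 + s) (b + 1) ∨ s ≤ n ∧ Simulates m hd cell b (k + 1 + s) s) := by
  induction s with
  | zero =>
    obtain ⟨h₁, h₂⟩ := h.atLeast_succ hb
    exact ⟨h₁, h₂.imp_right fun heq => ⟨Nat.zero_le n, h.simulates_zero hs hb.1 heq⟩⟩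
  | succ s ih =>
    obtain ⟨h₁, h₂⟩ := ih fun i hi => hsteps i (by omega)
    have hstep := hsteps s (Nat.lt_succ_self s)
    obtain ⟨h₃, h₄⟩ := h.atLeast_succ (h.promises_of_isStep hstep h₁)
    refine ⟨h₃, ?_⟩
    rcases h₂ with h₂ | ⟨hsn, hsim⟩
    · exact Or.inl (h.atLeast_succ (h.promises_of_isStep hstep h₂)).1
    · refine h₄.imp_right fun heq => ?_
      obtain ⟨hne, hsim'⟩ := h.simulates_succ hstep h₁.1 (by omega) heq hsim
      have : s ≠ n := by
        rintro rfl
        exact hne hn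
      exact ⟨by omega, hsim'⟩

/-- If the machine halts, then a round that starts with many active cells can end only if an active
cell is inserted, so that the next round starts with as many active cells. -/
theorem finish_of_halts (h : T.Rows (inputTape T.blank T.b₀ T.b₁ m) hd len cell img) {n k b s : ℕ}
    (hn : T.M (T.conf m n).q (T.conf m n).head = none) (hbn : n + 2 ≤ b)
    (hs : ¬ (hd k).op.IsStep) (hb : Promises len cell k b)
    (hsteps : ∀ i < s, (hd (k + 1 + i)).op.IsStep) (hend : ¬ (hd (k + 1 + s)).op.IsStep) :
    (hd (k + 1 + s)).op = .finish ∧ Promises len cell (k + 1 + s) b := by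
  obtain ⟨h₁, h₂⟩ := h.simulates_round hn hbn hs hb s hsteps
  have hlen := h₁.1
  have hfin : (hd (k + 1 + s)).op = .finish := by
    cases hop : (hd (k + 1 + s)).op with
    | finish => rfl
    | restart =>
      have hc := (h.cell_ok (k + 1 + s) 0 (h.len_pos _)).2
      rw [h.op_cell (h.len_pos _), hop] at hc
      exact absurd (h₁.2 0 (by omega)) hc.1
    | _ => rw [hop] at hend; exact (hend trivial).elim
  refine ⟨hfin, ?_⟩
  rcases h₂ with h₂ | ⟨hsn, hsim⟩
  · exact h.promises_of_finish hfin h₂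
  · have hc := (h.cell_ok (k + 1 + s) (b - 1) (by omega)).2
    rw [h.op_cell (by omega), hfin] at hc
    have := hsim.2.2.2 (b - 1) (by omega) (hc.1 (h₁.2 _ (by omega)))
    omega

/-- If the machine halts, then no phase ends after a round that starts with many active cells. -/
theorem ne_restart_of_halts (h : T.Rows (inputTape T.blank T.b₀ T.b₁ m) hd len cell img)
    {n k b : ℕ} (hn : T.M (T.conf m n).q (T.conf m n).head = none) (hbn : n + 2 ≤ b)
    (hs : ¬ (hd k).op.IsStep) (hb : Promises len cell k b) (j : ℕ) :
    (hd (k + 1 + j)).op ≠ .restart := by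
  have key : ∀ j, ∃ k' s, k + j = k' + s ∧ ¬ (hd k').op.IsStep ∧ Promises len cell k' b ∧
      ∀ i < s, (hd (k' + 1 + i)).op.IsStep := by
    intro j
    induction j with
    | zero => exact ⟨k, 0, rfl, hs, hb, fun i hi => absurd hi (Nat.not_lt_zero i)⟩
    | succ j ih =>
      obtain ⟨k', s, e, hs', hb', hsteps⟩ := ih
      by_cases hstep : (hd (k' + 1 + s)).op.IsStep
      · refine ⟨k', s + 1, by omega, hs', hb', fun i hi => ?_⟩
        rcases Nat.lt_succ_iff_lt_or_eq.1 hi with hi | rfl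
        · exact hsteps i hi
        · exact hstep
      · exact ⟨k' + 1 + s, 0, by omega, hstep, (h.finish_of_halts hn hbn hs' hb' hsteps hstep).2,
          fun i hi => absurd hi (Nat.not_lt_zero i)⟩
  obtain ⟨k', s, e, hs', hb', hsteps⟩ := key j
  intro hop
  have hend : (hd (k' + 1 + s)).op = .restart := by
    rwa [show k' + 1 + s = k + 1 + j by omega]
  have := (h.finish_of_halts hn hbn hs' hb' hsteps (by rw [hend]; exact id)).1
  rw [hend] at this
  cases this

/-- The phases start with rows of unbounded length. -/
theorem exists_le_len (h : T.Rows (inputTape T.blank T.b₀ T.b₁ m) hd len cell img) (n : ℕ) :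
    ∃ k, (hd k).op = .restart ∧ n ≤ len k := by
  have hmono : Monotone len := monotone_nat_of_le_succ fun k => by
    have h₁ := h.len_pos k
    have h₂ := h.le_img (k := k) (p := len k - 1) (by omega)
    have h₃ := h.img_lt k (len k - 1) (by omega)
    omega
  induction n with
  | zero => exact ⟨0, h.start, Nat.zero_le _⟩
  | succ n ih =>
    obtain ⟨k, hk, hn⟩ := ih
    obtain ⟨j, hj, hop⟩ := h.acc (k + 1)
    refine ⟨j, hop, ?_⟩
    have h₁ := h.len_pos k
    have h₂ := h.le_img (k := k) (p := len k - 1) (by omega)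
    have h₃ := h.grow k (len k - 1) hk (by omega)
    have h₄ := hmono hj
    omega

theorem not_halts (h : T.Rows (inputTape T.blank T.b₀ T.b₁ m) hd len cell img) :
    ¬ T.Halts m := by
  rw [halts_iff]
  rintro ⟨n, hn⟩
  obtain ⟨k, hk, hlen⟩ := h.exists_le_len (n + 2)
  obtain ⟨j, hj, hop⟩ := h.acc (k + 1)
  refine h.ne_restart_of_halts hn hlen (by rw [hk]; exact id) (h.promises_of_restart hk)
    (j - (k + 1)) ?_
  rwa [Nat.add_sub_cancel' hj]

end Rows

end

end Machine

/-! ### Rows for an input on which the machine does not halt -/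

/-- Reads rows letter by letter: `(k, 0)` stands for the header of the row number `k`, and
`(k, p + 1)` for its cell number `p`. -/
def rowPos (len : ℕ → ℕ) : ℕ → ℕ × ℕ
  | 0 => (0, 0)
  | i + 1 =>
    if (rowPos len i).2 < len (rowPos len i).1 then ((rowPos len i).1, (rowPos len i).2 + 1)
    else ((rowPos len i).1 + 1, 0)

/-- The time of a letter. The row number `k` is read in the interval `[k, k + 1)`, and letters with
the same position in consecutive rows are exactly one time unit apart. -/
noncomputable def rowTime (x : ℕ × ℕ) : ℝ := x.1 + (x.2 : ℝ) / (x.2 + 1)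

theorem le_rowTime (x : ℕ × ℕ) : (x.1 : ℝ) ≤ rowTime x :=
  le_add_of_nonneg_right (by positivity)

theorem rowTime_lt (x : ℕ × ℕ) : rowTime x < x.1 + 1 := by
  have : (x.2 : ℝ) / (x.2 + 1) < 1 := by
    rw [div_lt_one (by positivity)]
    linarith
  unfold rowTime
  linarith

theorem rowTime_succ_left (k p : ℕ) : rowTime (k + 1, p) = rowTime (k, p) + 1 := by
  simp only [rowTime, Nat.cast_add, Nat.cast_one]
  ring

theorem rowTime_lt_succ_right (k p : ℕ) : rowTime (k, p) < rowTime (k, p + 1) := by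
  simp only [rowTime, Nat.cast_add, Nat.cast_one]
  gcongr (k : ℝ) + ?_
  rw [div_lt_div_iff₀ (by positivity) (by positivity)]
  nlinarith

section

variable {len : ℕ → ℕ}

theorem rowPos_succ_of_lt {i k p : ℕ} (hi : rowPos len i = (k, p)) (hp : p < len k) :
    rowPos len (i + 1) = (k, p + 1) := by
  rw [rowPos, hi]
  exact if_pos hp

theorem rowPos_succ_of_le {i k p : ℕ} (hi : rowPos len i = (k, p)) (hp : len k ≤ p) :
    rowPos len (i + 1) = (k + 1, 0) := by
  rw [rowPos, hi]
  exact if_neg (not_lt.2 hp)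

theorem rowPos_snd_le {i k p : ℕ} (hi : rowPos len i = (k, p)) : p ≤ len k := by
  induction i generalizing k p with
  | zero =>
    cases hi
    exact Nat.zero_le _
  | succ i ih =>
    obtain ⟨k', p', hi'⟩ : ∃ k' p', rowPos len i = (k', p') := ⟨_, _, rfl⟩
    rcases lt_or_ge p' (len k') with hp | hp
    · rw [rowPos_succ_of_lt hi' hp] at hi
      cases hi
      exact hp
    · rw [rowPos_succ_of_le hi' hp] at hi
      cases hi
      exact Nat.zero_le _

theorem exists_rowPos_eq {k p : ℕ} (hp : p ≤ len k) : ∃ i, rowPos len i = (k, p) := by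
  have row : ∀ k, (∃ i, rowPos len i = (k, 0)) → ∀ p ≤ len k, ∃ i, rowPos len i = (k, p) := by
    intro k h₀ p
    induction p with
    | zero => exact fun _ => h₀
    | succ p ih =>
      intro hp
      obtain ⟨i, hi⟩ := ih (by omega)
      exact ⟨i + 1, rowPos_succ_of_lt hi hp⟩
  refine row k ?_ p hp
  clear hp
  induction k with
  | zero => exact ⟨0, rfl⟩
  | succ k ih =>
    obtain ⟨i, hi⟩ := row k ih (len k) le_rfl
    exact ⟨i + 1, rowPos_succ_of_le hi le_rfl⟩

theorem rowTime_rowPos_succ (i : ℕ) :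
    rowTime (rowPos len i) < rowTime (rowPos len (i + 1)) ∧
      rowTime (rowPos len (i + 1)) ≤ rowTime (rowPos len i) + 1 := by
  obtain ⟨k, p, hi⟩ : ∃ k p, rowPos len i = (k, p) := ⟨_, _, rfl⟩
  have h₁ := le_rowTime (k, p)
  have h₂ := rowTime_lt (k, p)
  simp only at h₁ h₂
  rcases lt_or_ge p (len k) with hp | hp
  · rw [rowPos_succ_of_lt hi hp, hi]
    have h₃ := rowTime_lt (k, p + 1)
    simp only at h₃
    exact ⟨rowTime_lt_succ_right k p, by linarith⟩
  · rw [rowPos_succ_of_le hi hp, hi]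
    have h₃ : rowTime (k + 1, 0) = k + 1 := by simp [rowTime]
    rw [h₃]
    exact ⟨h₂, by linarith⟩

theorem strictMono_rowTime_rowPos : StrictMono fun i => rowTime (rowPos len i) :=
  strictMono_nat_of_lt_succ fun i => (rowTime_rowPos_succ i).1

theorem exists_lt_rowTime_rowPos (M : ℝ) : ∃ i, M < rowTime (rowPos len i) := by
  obtain ⟨k, hk⟩ := exists_nat_gt M
  obtain ⟨i, hi⟩ := exists_rowPos_eq (len := len) (Nat.zero_le (len k))
  refine ⟨i, hk.trans_le ?_⟩
  rw [hi]
  exact le_rowTime (k, 0)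

end

namespace Machine

variable {T : Machine}

/-- The letter at a position, see `rowPos`. -/
def rowLetter (hd : ℕ → Header T.Q T.Γ) (cell : ℕ → ℕ → Cell T.Γ) : ℕ × ℕ → Letter T.Q T.Γ
  | (k, 0) => .header (hd k)
  | (k, p + 1) => .cell (cell k p)

/-- Rows without insertions, except at their ends, can be written as a word. -/
theorem Rows.stream {e : ℕ → T.Γ} {hd : ℕ → Header T.Q T.Γ} {len : ℕ → ℕ}
    {cell : ℕ → ℕ → Cell T.Γ} (h : T.Rows e hd len cell fun _ p => p) :
    T.spec.Stream e (fun i => rowLetter hd cell (rowPos len i))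
      fun i => rowTime (rowPos len i) := by
  have hmono : ∀ k, len k ≤ len (k + 1) := fun k => by
    have h₁ := h.len_pos k
    have h₂ := h.img_lt k (len k - 1) (by omega)
    omega
  have hop : ∀ k p, p < len k → (cell k p).op = (hd k).op := by
    intro k p
    induction p with
    | zero => exact fun _ => (h.first_ok k).1
    | succ p ih =>
      intro hp
      rw [(h.pair_ok k p hp).1, ih (by omega)]
  have hhdr : ∀ i, T.spec.hdr (rowLetter hd cell (rowPos len i)) →
      ∃ k, rowPos len i = (k, 0) := by
    intro i hi
    obtain ⟨k, p, hk⟩ : ∃ k p, rowPos len i = (k, p) := ⟨_, _, rfl⟩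
    rw [hk] at hi
    cases p with
    | zero => exact ⟨k, hk⟩
    | succ p => exact hi.elim
  refine ⟨⟨h.start, h.header_ok 0⟩, fun i => ?_, fun i j hij hj hj' => ?_,
    fun i => (rowTime_rowPos_succ i).2, fun i j hij hj hi hj' => ?_, fun i => ?_,
    fun i hi n hn g hg => ?_⟩
  · obtain ⟨k, p, hi⟩ : ∃ k p, rowPos len i = (k, p) := ⟨_, _, rfl⟩
    rcases lt_or_ge p (len k) with hp | hp
    · simp only [rowPos_succ_of_lt hi hp, hi]
      cases p with
      | zero => exact ⟨h.first_ok k, h.cell_ok k 0 hp⟩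
      | succ p => exact ⟨h.pair_ok k p hp, h.cell_ok k _ hp⟩
    · simp only [rowPos_succ_of_le hi hp, hi]
      cases p with
      | zero => exact absurd (h.len_pos k) (by omega)
      | succ p => exact h.header_ok _
  · obtain ⟨k, p, hi⟩ : ∃ k p, rowPos len i = (k, p) := ⟨_, _, rfl⟩
    have hp := rowPos_snd_le hi
    obtain ⟨j', hj₁⟩ := exists_rowPos_eq (hp.trans (hmono k))
    have ht : rowTime (rowPos len j') = rowTime (rowPos len i) + 1 := by
      rw [hj₁, hi, rowTime_succ_left]
    rw [← ht] at hj hj'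
    have h₁ := strictMono_rowTime_rowPos.le_iff_le.1 hj
    have h₂ := strictMono_rowTime_rowPos.lt_iff_lt.1 hj'
    obtain rfl : j = j' := by omega
    cases p with
    | zero =>
      simp only [hi, hj₁]
      exact h.hd_next k
    | succ p =>
      rcases lt_or_ge (p + 1) (len (k + 1)) with hlt | hge
      · simp only [hi, hj₁, rowPos_succ_of_lt hj₁ hlt]
        exact h.cur_img k p hp
      · simp only [hi, hj₁, rowPos_succ_of_le hj₁ hge]
        refine ⟨h.cur_img k p hp, fun hr => ?_⟩
        rw [hop k p hp] at hr
        exact absurd (h.grow k p hr hp) (by omega)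
  · obtain ⟨k, hi⟩ := hhdr i hi
    obtain ⟨k', hj'⟩ := hhdr j hj'
    have h₁ := strictMono_rowTime_rowPos (len := len) hij
    have h₂ := strictMono_rowTime_rowPos (len := len) (Nat.lt_succ_self j)
    simp only [hi, hj'] at h₁ h₂ hj
    have h₃ : rowTime (k, 0) = k := by simp [rowTime]
    have h₄ : rowTime (k', 0) = k' := by simp [rowTime]
    rw [h₃, h₄] at h₁
    rw [h₄] at h₂
    rw [h₃] at hj
    have h₅ : (k : ℝ) + 1 ≤ k' := by exact_mod_cast Nat.succ_le_of_lt (Nat.cast_lt.1 h₁)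
    linarith
  · obtain ⟨k, hk, hr⟩ := h.acc ((rowPos len i).1 + 1)
    obtain ⟨j, hj⟩ := exists_rowPos_eq (Nat.zero_le (len k))
    refine ⟨j, ?_, ?_⟩
    · refine (strictMono_rowTime_rowPos (len := len)).le_iff_le.1 ?_
      simp only [hj]
      have h₁ := rowTime_lt (rowPos len i)
      have h₂ := le_rowTime (k, 0)
      have h₃ : ((rowPos len i).1 : ℝ) + 1 ≤ k := by exact_mod_cast hk
      simp only at h₂
      linarith
    · simp only [hj]
      exact hr
  · obtain ⟨k, p, hk⟩ : ∃ k p, rowPos len i = (k, p) := ⟨_, _, rfl⟩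
    simp only [hk] at hi
    cases p with
    | succ p => exact hi.elim
    | zero =>
      have key : ∀ r ≤ n, rowPos len (i + 1 + r) = (k, r + 1) := by
        intro r
        induction r with
        | zero => exact fun _ => rowPos_succ_of_lt hk (h.len_pos k)
        | succ r ih =>
          intro hr
          have hr' := ih (by omega)
          rcases lt_or_ge (r + 1) (len k) with hlt | hge
          · exact rowPos_succ_of_lt hr' hlt
          · have hnext := rowPos_succ_of_le hr' hge
            -- the next letter would be a header, which has no value
            rcases hr.lt_or_eq with hr | rfl
            · have := hn (r + 1) hr
              simp only [← add_assoc, hnext] at this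
              exact absurd rfl this
            · simp only [← add_assoc, hnext] at hg
              cases hg
      have hn' := key n le_rfl
      simp only [hn'] at hg
      cases hg
      exact h.input k n hi (rowPos_snd_le hn')

/-- The stage of the intended computation at a row: the length of the row, the number of active
cells, and the number of steps made in the present round. -/
structure Stage where
  len : ℕ
  active : ℕ
  steps : ℕ

/-- A round takes as many steps as there are active cells. Each round but the first of a phase has
one active cell less than the one before, and each phase uses one cell more. -/
def Stage.succ (x : Stage) : Stage :=
  if x.steps < x.active then ⟨x.len, x.active, x.steps + 1⟩
  else if x.active = 0 then ⟨x.len + 1, x.len + 1, 0⟩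
  else ⟨x.len, x.active - 1, 0⟩

/-- The stage at the row number `k`. -/
def stage (k : ℕ) : Stage := Stage.succ^[k] ⟨1, 0, 0⟩

theorem stage_succ (k : ℕ) : stage (k + 1) = (stage k).succ :=
  Function.iterate_succ_apply' _ k _

theorem stage_spec (k : ℕ) : 0 < (stage k).len ∧ (stage k).steps ≤ (stage k).active := by
  induction k with
  | zero => exact ⟨Nat.one_pos, le_rfl⟩
  | succ k ih =>
    rw [stage_succ]
    unfold Stage.succ
    split_ifs <;> simp only <;> omega

theorem exists_active_eq_zero (k : ℕ) : ∃ j ≥ k, (stage j).active = 0 := by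
  have key : ∀ a r k, (stage k).active = a → (stage k).steps + r = a →
      ∃ j ≥ k, (stage j).active = 0 := by
    intro a
    induction a with
    | zero => exact fun r k ha _ => ⟨k, le_rfl, ha⟩
    | succ a iha =>
      intro r
      induction r with
      | zero =>
        intro k ha hs
        have h : stage (k + 1) = ⟨(stage k).len, a, 0⟩ := by
          rw [stage_succ, Stage.succ, if_neg (by omega), if_neg (by omega), ha,
            Nat.add_sub_cancel]
        obtain ⟨j, hj, h₀⟩ := iha a (k + 1) (by rw [h]) (by rw [h]; exact Nat.zero_add a)
        exact ⟨j, by omega, h₀⟩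
      | succ r ihr =>
        intro k ha hs
        have h : stage (k + 1) = ⟨(stage k).len, a + 1, (stage k).steps + 1⟩ := by
          rw [stage_succ, Stage.succ, if_pos (by omega), ha]
        obtain ⟨j, hj, h₀⟩ := ihr (k + 1) (by rw [h]) (by rw [h]; simp only; omega)
        exact ⟨j, by omega, h₀⟩
  exact key _ ((stage k).active - (stage k).steps) k rfl (by have := (stage_spec k).2; omega)

/-- The operation that performs an instruction. -/
def opOf {Q Γ : Type} : Option (Q × TM0.Stmt Γ) → Op
  | some (_, .move .right) => .right
  | some (_, .move .left) => .left
  | _ => .stay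

section

variable (T) (m : ℕ)

/-- The configuration at the row number `k`. -/
def rowConf (k : ℕ) : TapeCfg T.Q T.Γ := T.conf m (stage k).steps

/-- The operation on the row number `k`. -/
def rowOp (k : ℕ) : Op :=
  if (stage k).steps < (stage k).active then opOf (T.M (T.rowConf m k).q (T.rowConf m k).head)
  else if (stage k).active = 0 then .restart else .finish

/-- The header of the row number `k`. -/
def rowHeader (k : ℕ) : Header T.Q T.Γ :=
  ⟨T.rowOp m k, (T.rowConf m k).q, (T.rowConf m k).head, (T.rowConf m (k + 1)).q,
    (T.rowConf m (k + 1)).head⟩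

/-- The content of the cell number `p` of the row number `k`. -/
def rowContent (k p : ℕ) : Content T.Γ :=
  ⟨decide (Odd p), decide (p < (stage k).active), decide (p < (stage k).steps),
    (T.rowConf m k).left p, (T.rowConf m k).right p⟩

/-- The cell number `p` of the row number `k`. -/
def rowCell (k p : ℕ) : Cell T.Γ := ⟨T.rowOp m k, T.rowContent m k p, T.rowContent m (k + 1) p⟩

end

/-- If the machine does not halt, then its computation can be written down as rows in which
each phase ends. -/
theorem rows_of_not_halts {m : ℕ} (hm : ¬ T.Halts m) :
    T.Rows (inputTape T.blank T.b₀ T.b₁ m) (T.rowHeader m) (fun k => (stage k).len) (T.rowCell m)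
      fun _ p => p := by
  have hne : ∀ n, T.M (T.conf m n).q (T.conf m n).head ≠ none := fun n hn =>
    hm (halts_iff.2 ⟨n, hn⟩)
  have hpar : ∀ p, decide (Odd (p + 1)) ≠ decide (Odd p) := by
    intro p
    rw [Ne, decide_eq_decide, Nat.odd_add_one]
    tauto
  -- the three kinds of rows
  have hcases : ∀ k,
      ((∃ q s, T.M (T.rowConf m k).q (T.rowConf m k).head = some (q, s) ∧
          T.rowConf m (k + 1) = (T.rowConf m k).apply q s ∧ T.rowOp m k = opOf (some (q, s))) ∧
        stage (k + 1) = ⟨(stage k).len, (stage k).active, (stage k).steps + 1⟩) ∨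
      (T.rowOp m k = .restart ∧ T.rowConf m (k + 1) = T.init m ∧ (stage k).active = 0 ∧
        stage (k + 1) = ⟨(stage k).len + 1, (stage k).len + 1, 0⟩) ∨
      (T.rowOp m k = .finish ∧ T.rowConf m (k + 1) = T.init m ∧
        (stage k).active = (stage k).steps ∧
        stage (k + 1) = ⟨(stage k).len, (stage k).active - 1, 0⟩) := by
    intro k
    have hle := (stage_spec k).2
    unfold rowOp
    by_cases h₁ : (stage k).steps < (stage k).active
    · left
      have hs : stage (k + 1) = ⟨(stage k).len, (stage k).active, (stage k).steps + 1⟩ := by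
        rw [stage_succ, Stage.succ, if_pos h₁]
      obtain ⟨⟨q, s⟩, hqs⟩ := Option.ne_none_iff_exists'.1 (hne (stage k).steps)
      refine ⟨⟨q, s, hqs, ?_, ?_⟩, hs⟩
      · unfold rowConf
        rw [hs]
        exact conf_succ_of_eq_some hqs
      · rw [if_pos h₁]
        exact congrArg opOf hqs
    · right
      by_cases h₂ : (stage k).active = 0
      · left
        have hs : stage (k + 1) = ⟨(stage k).len + 1, (stage k).len + 1, 0⟩ := by
          rw [stage_succ, Stage.succ, if_neg h₁, if_pos h₂]
        refine ⟨by rw [if_neg h₁, if_pos h₂], ?_, h₂, hs⟩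
        unfold rowConf
        rw [hs]
        rfl
      · right
        have hs : stage (k + 1) = ⟨(stage k).len, (stage k).active - 1, 0⟩ := by
          rw [stage_succ, Stage.succ, if_neg h₁, if_neg h₂]
        refine ⟨by rw [if_neg h₁, if_neg h₂], ?_, by omega, hs⟩
        unfold rowConf
        rw [hs]
        rfl
  constructor
  case header_ok =>
    intro k
    unfold HeaderOk
    simp only [rowHeader]
    rcases hcases k with ⟨⟨q, s, hM, hc, ho⟩, -⟩ | ⟨ho, hc, -⟩ | ⟨ho, hc, -⟩
    · rw [ho, hc, hM]
      rcases s with (_ | _) | _ <;> rfl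
    · rw [ho, hc]
      exact ⟨rfl, rfl⟩
    · rw [ho, hc]
      exact ⟨rfl, rfl⟩
  case len_pos => exact fun k => (stage_spec k).1
  case first_ok =>
    intro k
    refine ⟨rfl, ?_⟩
    simp only [rowHeader, rowCell, rowContent]
    rcases hcases k with ⟨⟨q, s, hM, hc, ho⟩, hs⟩ | ⟨ho, -⟩ | ⟨ho, -⟩
    · rw [ho, hc, hs]
      rcases s with (_ | _) | _ <;> simp [opOf, TapeCfg.apply, push]
    · simp [ho]
    · simp [ho]
  case cell_ok =>
    intro k p hp
    refine ⟨rfl, ?_⟩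
    simp only [rowCell, rowContent]
    rcases hcases k with ⟨⟨q, s, hM, hc, ho⟩, hs⟩ | ⟨ho, hc, ha, hs⟩ | ⟨ho, hc, ha, hs⟩
    · rw [ho, hc, hs]
      rcases s with (_ | _) | _ <;> simp [opOf, TapeCfg.apply]
    · rw [ho, hc, hs]
      simp only [ha, Machine.init, decide_eq_true_eq, and_true, Nat.not_lt_zero, not_false_eq_true,
        true_and]
      omega
    · rw [ho, hc, hs]
      simp [ha, Machine.init]
  case pair_ok =>
    intro k p hp
    refine ⟨rfl, hpar p, ?_⟩
    simp only [rowCell, rowContent, decide_eq_true_eq]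
    refine ⟨by omega, ?_⟩
    rcases hcases k with ⟨⟨q, s, hM, hc, ho⟩, hs⟩ | ⟨ho, hc, ha, hs⟩ | ⟨ho, hc, ha, hs⟩
    · rw [ho, hc, hs]
      rcases s with (_ | _) | _ <;> simp [opOf, TapeCfg.apply, push]
    · rw [ho]
      trivial
    · rw [ho, hs]
      simp only
      omega
  case hd_next => exact fun k => ⟨rfl, rfl⟩
  case img_lt =>
    intro k p hp
    rcases hcases k with ⟨-, hs⟩ | ⟨-, -, -, hs⟩ | ⟨-, -, -, hs⟩ <;> rw [hs] <;> simp only <;> omega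
  case img_strictMono => exact fun _ _ _ hp _ => hp
  case cur_img => exact fun _ _ _ => rfl
  case grow =>
    intro k p hr hp
    simp only [rowHeader] at hr
    rcases hcases k with ⟨⟨q, s, hM, hc, ho⟩, hs⟩ | ⟨ho, hc, ha, hs⟩ | ⟨ho, hc, ha, hs⟩
    · rw [ho] at hr
      rcases s with (_ | _) | _ <;> cases hr
    · rw [hs]
      simp only
      omega
    · rw [ho] at hr
      cases hr
  case input =>
    intro k p hr hp
    simp only [rowHeader] at hr
    simp only [rowCell, rowContent]
    rcases hcases k with ⟨⟨q, s, hM, hc, ho⟩, hs⟩ | ⟨ho, hc, ha, hs⟩ | ⟨ho, hc, ha, hs⟩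
    · rw [ho] at hr
      rcases s with (_ | _) | _ <;> exact (hr trivial).elim
    · rw [hc]
      rfl
    · rw [hc]
      rfl
  case acc =>
    intro k
    obtain ⟨j, hj, ha⟩ := exists_active_eq_zero k
    refine ⟨j, hj, ?_⟩
    simp only [rowHeader, rowOp]
    rw [if_neg (by omega), if_pos ha]
  case start => rfl

/-- The automaton of an input accepts some non-Zeno word if and only if the machine does not halt on
this input. -/
theorem acceptsNonZeno_iff (T : Machine) (m : ℕ) :
    (T.spec.automaton T.blank T.b₀ T.b₁ m).AcceptsNonZeno ↔ ¬ T.Halts m := by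
  rw [StreamSpec.acceptsNonZeno_iff]
  constructor
  · rintro ⟨ℓ, t, ht, -, hz, h⟩
    obtain ⟨hd, len, cell, img, hr⟩ := exists_rows h ht hz
    exact hr.not_halts
  · intro hm
    exact ⟨_, _, strictMono_rowTime_rowPos,
      fun i => (Nat.cast_nonneg _).trans (le_rowTime _),
      exists_lt_rowTime_rowPos, (rows_of_not_halts hm).stream⟩

end Machine

end OneClock

theorem theorem5p2 :
    ¬ OneClock.DecidableOn
      (fun A : OneClock.Automaton => A.WellFormed ∧ A.Universal ∧ A.HasIndex 1 2 ∧
        A.NoEqualityTests ∧ A.OnlyTestsAboveOne)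
      (fun A : OneClock.Automaton => A.AcceptsNonZeno) := by
  rintro ⟨f, hf, hdec⟩
  obtain ⟨T, hT⟩ := OneClock.exists_undecidable_machine
  have hrestr : ∀ m, OneClock.Restricted (T.spec.automaton T.blank T.b₀ T.b₁ m) := fun _ =>
    OneClock.StreamSpec.automaton_restricted
  have htotal : ∀ m, (f (T.spec.automaton T.blank T.b₀ T.b₁ m)).Dom := fun m =>
    let ⟨_, hb, _⟩ := hdec _ (hrestr m)
    Part.dom_iff_mem.2 ⟨_, hb⟩
  have hcomp : Computable fun m => (f (T.spec.automaton T.blank T.b₀ T.b₁ m)).get (htotal m) :=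
    (hf.comp (OneClock.StreamSpec.computable_automaton (X := T.spec))).of_eq
      fun m => (Part.some_get (htotal m)).symm
  have hpred : ComputablePred fun m => ¬ T.Halts m := by
    refine ComputablePred.computable_iff.2 ⟨_, hcomp, ?_⟩
    funext m
    obtain ⟨b, hb, hiff⟩ := hdec _ (hrestr m)
    rw [Part.get_eq_of_mem hb (htotal m)]
    exact propext ((T.acceptsNonZeno_iff m).symm.trans hiff.symm)
  refine hT (hpred.not.of_eq fun m => ?_)
  exact not_not
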